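/- **Setting.** Fix a buffer size $M\ge 1$ and an input stream $I$ of $N$ elements of a linearly ordered set (repeated elements are allowed). Initially the buffer holds the first $\min(M,N)$ elements of $I$. In each step one element of the buffer is ejected and appended to the output sequence $S$, and the next unread element of $I$, if there is one, takes up the freed slot; this continues until nothing is left. The sequences $S$ that can arise are the possible outputs on $I$. A run is a weakly increasing or weakly decreasing sequence, $R(S)$ is the smallest number of runs whose concatenation is $S$, and $\mathrm{OPT}=\mathrm{OPT}(I)$ is the minimum of $R(S)$ over all possible outputs $S$ on $I$. An offline algorithm is given the whole input ($I$, $M$, and the accuracy through the number $\lceil 1/\varepsilon\rceil$) and computes a possible output $S$. It is a fixed program on linked binary-tree data (first-order Lisp), in which every elementary operation and every comparison of two elements takes one step; $I$ is given as a linked list and the numbers $M$, $\lceil 1/\varepsilon\rceil$ in unary. The running time is the number of steps, and the constants in $O(\cdot)$ below do not depend on $\varepsilon$, $M$, $N$, $I$ or the ordered set. **Theorem.** (1) There is an offline algorithm that, for every $\varepsilon>0$, $M\ge1$ and every input $I$, halts with a possible output $S$ on $I$ such that $R(S)\le(1+\varepsilon)\cdot\mathrm{OPT}$, and whose running time is $O(\varphi^{1/\varepsilon}\,N\log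 N)$ for $N\ge 2$, where $\varphi=(1+\sqrt5)/2$ is the golden ratio. (2) There is likewise an offline algorithm that always writes a possible output $S$ with $R(S)\le(1+\varepsilon)\cdot\mathrm{OPT}$, with running time $O(2^{1/\varepsilon}\,N\log N)$ for $N\ge2$. -/

import Mathlib

namespace RunGen

/-! ### The run-generation problem -/

section Problem

variable {α : Type*}

/-- `Writes B J S`: starting with buffer contents `B` and unread input `J`, the sequence `S` can be
written.  In each step some element of the buffer is appended to the output, and the next unread
input element (if there is one) takes up the freed slot; the process ends when nothing is left. -/
inductive Writes : List α → List α → List α → Prop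
  | done : Writes [] [] []
  | write (l r J S : List α) (a : α) :
      Writes (l ++ r ++ J.take 1) (J.drop 1) S → Writes (l ++ a :: r) J (a :: S)

/-- `S` is a possible output sequence on input stream `I` with a buffer of size `M`; at the start
the buffer holds the first `M` elements of `I`. -/
def IsOutput (M : ℕ) (I S : List α) : Prop :=
  Writes (I.take M) (I.drop M) S

/-- With a buffer of positive size, every input has a possible output, e.g. the input itself. -/
theorem isOutput_self {M : ℕ} (hM : 1 ≤ M) (I : List α) : IsOutput M I I := by
  have key : ∀ (n : ℕ) (I : List α), I.length = n → IsOutput M I I := by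
    intro n
    induction n with
    | zero =>
      intro I hI
      obtain rfl := List.length_eq_zero_iff.mp hI
      simpa [IsOutput] using Writes.done
    | succ n ih =>
      intro I hI
      cases I with
      | nil => simp at hI
      | cons a I =>
        obtain ⟨m, rfl⟩ : ∃ m, M = m + 1 := ⟨M - 1, by omega⟩
        have h := ih I (by simpa using hI)
        unfold IsOutput at h ⊢
        have := Writes.write [] (I.take m) (I.drop m) I a
          (by simpa [List.take_add, List.drop_drop] using h)
        simpa using this
  exact key _ I rfl

variable [LinearOrder α]

/-- A run is a sorted or reverse-sorted sequence (equal elements are allowed). -/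
def IsRun (r : List α) : Prop :=
  r.Pairwise (· ≤ ·) ∨ r.Pairwise (· ≥ ·)

/-- `runs S` is the smallest number of runs whose concatenation is `S`. -/
noncomputable def runs (S : List α) : ℕ :=
  sInf {n | ∃ L : List (List α), L.length = n ∧ L.flatten = S ∧ ∀ r ∈ L, IsRun r}

/-- `opt M I` is the minimum number of runs of any possible output on input `I` with a buffer of
size `M`. -/
noncomputable def opt (M : ℕ) (I : List α) : ℕ :=
  sInf {n | ∃ S : List α, IsOutput M I S ∧ runs S = n}

end Problem

/-! ### The machine model

First-order pure Lisp with call-by-value evaluation.  Data are binary trees whose leaves are `nil`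
or opaque input elements, and input elements can only be compared.  Programs are finite, and the
running time is the number of evaluation steps.  For a fixed program the number of variables in
scope is bounded, so that each step is a constant number of pointer operations of a
random-access machine (and at most one comparison of elements). -/

section Machine

/-- Data: binary trees with leaves `nil` and `atom a`. -/
inductive Val (α : Type*)
  | nil : Val α
  | atom (a : α) : Val α
  | cons (x y : Val α) : Val α

namespace Val

variable {α : Type*}

def fst : Val α → Val α
  | cons x _ => x
  | _ => nil

def snd : Val α → Val α
  | cons _ y => y
  | _ => nil

/-- Comparison of two input elements; `nil` stands for "false", any other value for "true". -/
def le [LinearOrder α] : Val α → Val α → Val α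
  | atom a, atom b => if a ≤ b then cons nil nil else nil
  | _, _ => nil

/-- A sequence of elements as a linked list of atoms. -/
def ofList : List α → Val α
  | [] => nil
  | a :: l => cons (atom a) (ofList l)

/-- A natural number in unary, as a linked list of `nil`s. -/
def ofNat : ℕ → Val α
  | 0 => nil
  | n + 1 => cons nil (ofNat n)

end Val

/-- Expressions.  Variables are de Bruijn indices into the environment, `letE e b` evaluates `b`
with the value of `e` as new variable `0`, and `call f e` calls the function number `f` of the
program. -/
inductive Expr
  | var (i : ℕ) : Expr
  | nil : Expr
  | cons (e₁ e₂ : Expr) : Expr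
  | fst (e : Expr) : Expr
  | snd (e : Expr) : Expr
  | le (e₁ e₂ : Expr) : Expr
  | ite (c e₁ e₂ : Expr) : Expr
  | letE (e b : Expr) : Expr
  | call (f : ℕ) (e : Expr) : Expr

/-- A program is a finite list of (mutually recursive) functions of one argument, each given by its
body, in which variable `0` is the argument. -/
abbrev Program := List Expr

/-- `Eval P ρ e v t`: in program `P` and environment `ρ`, the expression `e` evaluates to the value
`v` in `t` steps. -/
inductive Eval {α : Type*} [LinearOrder α] (P : Program) :
    List (Val α) → Expr → Val α → ℕ → Prop
  | var {ρ : List (Val α)} {i : ℕ} {v : Val α} :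
      ρ[i]? = some v → Eval P ρ (.var i) v 1
  | nil {ρ : List (Val α)} : Eval P ρ .nil .nil 1
  | cons {ρ : List (Val α)} {e₁ e₂ : Expr} {v₁ v₂ : Val α} {t₁ t₂ : ℕ} :
      Eval P ρ e₁ v₁ t₁ → Eval P ρ e₂ v₂ t₂ →
      Eval P ρ (.cons e₁ e₂) (.cons v₁ v₂) (t₁ + t₂ + 1)
  | fst {ρ : List (Val α)} {e : Expr} {v : Val α} {t : ℕ} :
      Eval P ρ e v t → Eval P ρ (.fst e) v.fst (t + 1)
  | snd {ρ : List (Val α)} {e : Expr} {v : Val α} {t : ℕ} :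
      Eval P ρ e v t → Eval P ρ (.snd e) v.snd (t + 1)
  | le {ρ : List (Val α)} {e₁ e₂ : Expr} {v₁ v₂ : Val α} {t₁ t₂ : ℕ} :
      Eval P ρ e₁ v₁ t₁ → Eval P ρ e₂ v₂ t₂ →
      Eval P ρ (.le e₁ e₂) (v₁.le v₂) (t₁ + t₂ + 1)
  | ite_true {ρ : List (Val α)} {c e₁ e₂ : Expr} {u v : Val α} {s t : ℕ} :
      Eval P ρ c u s → u ≠ .nil → Eval P ρ e₁ v t →
      Eval P ρ (.ite c e₁ e₂) v (s + t + 1)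
  | ite_false {ρ : List (Val α)} {c e₁ e₂ : Expr} {v : Val α} {s t : ℕ} :
      Eval P ρ c .nil s → Eval P ρ e₂ v t →
      Eval P ρ (.ite c e₁ e₂) v (s + t + 1)
  | letE {ρ : List (Val α)} {e b : Expr} {u v : Val α} {s t : ℕ} :
      Eval P ρ e u s → Eval P (u :: ρ) b v t →
      Eval P ρ (.letE e b) v (s + t + 1)
  | call {ρ : List (Val α)} {f : ℕ} {e b : Expr} {u v : Val α} {s t : ℕ} :
      Eval P ρ e u s → P[f]? = some b → Eval P [u] b v t →
      Eval P ρ (.call f e) v (s + t + 1)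

/-- Evaluation is deterministic: an expression has at most one value and one running time. -/
theorem Eval.unique {α : Type*} [LinearOrder α] {P : Program} {ρ : List (Val α)} {e : Expr}
    {v v' : Val α} {t t' : ℕ} (h : Eval P ρ e v t) (h' : Eval P ρ e v' t') : v = v' ∧ t = t' := by
  induction h generalizing v' t' with
  | var h1 => cases h' with | var h2 => simp_all
  | nil => cases h'; simp
  | cons _ _ ih1 ih2 =>
    cases h' with
    | cons h1 h2 =>
      obtain ⟨rfl, rfl⟩ := ih1 h1
      obtain ⟨rfl, rfl⟩ := ih2 h2
      simp
  | fst _ ih1 => cases h' with | fst h1 => obtain ⟨rfl, rfl⟩ := ih1 h1; simp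
  | snd _ ih1 => cases h' with | snd h1 => obtain ⟨rfl, rfl⟩ := ih1 h1; simp
  | le _ _ ih1 ih2 =>
    cases h' with
    | le h1 h2 =>
      obtain ⟨rfl, rfl⟩ := ih1 h1
      obtain ⟨rfl, rfl⟩ := ih2 h2
      simp
  | ite_true _ hn _ ih1 ih2 =>
    cases h' with
    | ite_true h1 _ h2 =>
      obtain ⟨rfl, rfl⟩ := ih1 h1
      obtain ⟨rfl, rfl⟩ := ih2 h2
      simp
    | ite_false h1 h2 => exact absurd (ih1 h1).1 hn
  | ite_false _ _ ih1 ih2 =>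
    cases h' with
    | ite_true h1 hn h2 => exact absurd (ih1 h1).1.symm hn
    | ite_false h1 h2 =>
      obtain ⟨_, rfl⟩ := ih1 h1
      obtain ⟨rfl, rfl⟩ := ih2 h2
      simp
  | letE _ _ ih1 ih2 =>
    cases h' with
    | letE h1 h2 =>
      obtain ⟨rfl, rfl⟩ := ih1 h1
      obtain ⟨rfl, rfl⟩ := ih2 h2
      simp
  | call _ hb _ ih1 ih2 =>
    cases h' with
    | call h1 hb' h2 =>
      obtain ⟨rfl, rfl⟩ := ih1 h1
      obtain rfl : _ = _ := Option.some.inj (hb.symm.trans hb')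
      obtain ⟨rfl, rfl⟩ := ih2 h2
      simp

/-- The program `P` (started with its function number `0`), given the numbers `k` and `M` and the
list `I` of elements, halts after `t` steps with the list `S` as its result. -/
def Program.OutputsIn {α : Type*} [LinearOrder α] (P : Program) (k M : ℕ) (I S : List α) (t : ℕ) :
    Prop :=
  Eval P [.cons (.ofNat k) (.cons (.ofNat M) (.ofList I))] (.call 0 (.var 0)) (.ofList S) t

end Machine

end RunGen

/-!
Items are the positions of the input, so that equal elements can be told apart.  When a set `W` of
items has been written, the items `z < |W| + M` have been read, so a state of the buffer is just a
set `W`.  A greedy run in one of the two directions always writes the next eligible item of the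
buffer; it leaves behind only items that were read when the run had already passed them
(`IsFullRun`).  Three facts about sets of written items carry the proof.

* A greedy run from `W` keeps up with every run of the same direction from any `V ⊆ W`
  (`IsFullRun.mono_state`).  Hence some sequence of greedy runs is optimal, and only the directions
  have to be chosen.
* A greedy run from `W` writes the whole buffer, hence everything that any strategy which is not
  ahead in time has written (`IsFullRun.subset_of_card_le`).  So one additional run brings the
  algorithm ahead of any strategy that has written at most as many items.
* If the first run is taken in the direction in which it is shorter, then it is useless to switch
  afterwards to the other direction, because taking the longer direction twice is at least as good
  (`IsFullRun.prune`).  So a search for the best `k` runs has to consider only "longer" and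
  "shorter, shorter" as first moves, and visits a Fibonacci number of states.

The algorithm works in blocks.  With `k = ⌈1 / ε⌉`, a block searches for the `j = 1, …, k` runs that
write as much as possible, stops if everything gets written, and otherwise adds one more run after
`j = k`.  It is then ahead of the first `k` runs of an optimal strategy, so that `r = OPT` runs
become at most `r + (r - 1) / k ≤ (1 + ε) r` (`block_spec`, `res_main`).

A greedy run of `n` items takes time `O(n log N)` with a heap, which is rebuilt at the start of each
run; this is paid for by the run, which writes the whole buffer.  Within a block no state that is
considered has written more than the one that is chosen in the end, so a block takes time
`O(fib (k + 4) * log N)` per element that it writes, and `fib k ≤ φ ^ k`.  The bound with `2` in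
place of `φ` is weaker, and the same program satisfies it.

The program is verified by means of total functions for the value and the running time of
expressions (`den`, `tm`), which are correct where the evaluation succeeds (`Safe.eval`).
-/

namespace RunGen

/-! ### Runs as sets of items -/

section Combinatorics

variable {α : Type*} [LinearOrder α] {N : ℕ}

/-- The order in which a run of direction `b` is sorted: `≤` if `b` is `true`, and `≥` otherwise. -/
def DirLE (b : Bool) (x y : α) : Prop :=
  if b then x ≤ y else y ≤ x

instance (b : Bool) (x y : α) : Decidable (DirLE b x y) := by
  unfold DirLE; infer_instance

theorem DirLE.refl (b : Bool) (x : α) : DirLE b x x := by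
  cases b <;> simp [DirLE]

theorem DirLE.trans {b : Bool} {x y z : α} (h : DirLE b x y) (h' : DirLE b y z) :
    DirLE b x z := by
  cases b <;> simp only [DirLE, Bool.false_eq_true, if_true, if_false] at * <;> order

theorem DirLE.of_not {b : Bool} {x y : α} (h : ¬ DirLE b x y) : DirLE b y x := by
  cases b <;> simp only [DirLE, Bool.false_eq_true, if_true, if_false] at * <;> order

theorem dirLE_not {b : Bool} {x y : α} : DirLE (!b) x y ↔ DirLE b y x := by
  cases b <;> simp [DirLE]

theorem isRun_of_pairwise_dirLE {b : Bool} {l : List α} (h : l.Pairwise (DirLE b)) : IsRun l := by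
  cases b
  · exact Or.inr (h.imp (by simp [DirLE]))
  · exact Or.inl (h.imp (by simp [DirLE]))

theorem IsRun.exists_dirLE {l : List α} (h : IsRun l) : ∃ b, l.Pairwise (DirLE b) := by
  rcases h with h | h
  · exact ⟨true, h.imp (by simp [DirLE])⟩
  · exact ⟨false, h.imp (by simp [DirLE])⟩

/-- The items are the positions `Fin N` of the input, and `key` gives their values.  After the items
of `W` have been written, exactly the items `z < |W| + M` have been read.  `IsRunFrom M key b W L`:
from this state on, the items `L` can be written one after the other, and they form a run of
direction `b`. -/
structure IsRunFrom (M : ℕ) (key : Fin N → α) (b : Bool) (W : Finset (Fin N))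
    (L : List (Fin N)) : Prop where
  nodup : L.Nodup
  disj : ∀ x ∈ L, x ∉ W
  arr : ∀ L₁ x L₂, L = L₁ ++ x :: L₂ → x.val < W.card + L₁.length + M
  mono : L.Pairwise fun x y => DirLE b (key x) (key y)

/-- A run that leaves nothing behind that it could have taken: it contains everything which is in
the buffer when it starts, and an item that is read when `x` is written, and is not part of the run,
belongs strictly before `x`. -/
structure IsFullRun (M : ℕ) (key : Fin N → α) (b : Bool) (W : Finset (Fin N))
    (L : List (Fin N)) : Prop extends IsRunFrom M key b W L where
  init : ∀ z : Fin N, z.val < W.card + M → z ∈ W ∨ z ∈ L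
  full : ∀ L₁ x L₂, L = L₁ ++ x :: L₂ → ∀ z : Fin N, z ∉ W → z ∉ L →
    z.val = W.card + M + L₁.length → ¬ DirLE b (key x) (key z)

variable {M : ℕ} {key : Fin N → α} {b : Bool} {V W X : Finset (Fin N)} {L L' : List (Fin N)}

theorem IsRunFrom.of_append (h : IsRunFrom M key b W (L ++ L')) : IsRunFrom M key b W L where
  nodup := h.nodup.of_append_left
  disj x hx := h.disj x (by simp [hx])
  arr L₁ x L₂ e := h.arr L₁ x (L₂ ++ L') (by simp [e])
  mono := (List.pairwise_append.1 h.mono).1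

theorem IsRunFrom.card_union (h : IsRunFrom M key b W L) :
    (W ∪ L.toFinset).card = W.card + L.length := by
  rw [Finset.card_union_of_disjoint, List.toFinset_card_of_nodup h.nodup]
  rw [Finset.disjoint_left]
  intro x hx hx'
  exact h.disj x (by simpa using hx') hx

theorem IsRunFrom.card_union_append (h : IsRunFrom M key b W (L ++ L')) :
    (W ∪ L.toFinset).card = W.card + L.length :=
  h.of_append.card_union

theorem IsFullRun.subset_of_card_le (h : IsFullRun M key b W L)
    (hV : ∀ z ∈ V, z.val < V.card + M) (hc : V.card ≤ W.card) : V ⊆ W ∪ L.toFinset := by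
  intro z hz
  have := hV z hz
  simpa using h.init z (by omega)

/-- An item which a full run leaves behind was read during the run, when the item written was
strictly beyond it. -/
theorem IsFullRun.exists_split (h : IsFullRun M key b W L) {z : Fin N} (hz : z ∉ W) (hz' : z ∉ L)
    (hlt : z.val < W.card + L.length + M) :
    ∃ L₁ x L₂, L = L₁ ++ x :: L₂ ∧ z.val = W.card + M + L₁.length ∧
      ¬ DirLE b (key x) (key z) := by
  have h1 : W.card + M ≤ z.val := by
    by_contra hc
    rcases h.init z (by omega) with h2 | h2
    · exact hz h2
    · exact hz' h2
  have hi : z.val - (W.card + M) < L.length := by omega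
  have e : L = L.take (z.val - (W.card + M)) ++
      L[z.val - (W.card + M)] :: L.drop (z.val - (W.card + M) + 1) := by simp
  have hl : z.val = W.card + M + (L.take (z.val - (W.card + M))).length := by
    simp only [List.length_take]; omega
  exact ⟨_, _, _, e, hl, h.full _ _ _ e z hz hz' hl⟩

/-- Being ahead is preserved by runs: if everything written in state `V` has also been written in
state `W`, then a full run from `W` keeps up with any run of the same direction from `V`. -/
theorem IsFullRun.mono_state (h : IsFullRun M key b W L) (h' : IsRunFrom M key b V L')
    (hVW : V ⊆ W) : V ∪ L'.toFinset ⊆ W ∪ L.toFinset := by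
  induction L' using List.reverseRecOn with
  | nil => simpa using hVW.trans Finset.subset_union_left
  | append_singleton L' y ih =>
    have ih := ih h'.of_append
    suffices hy : y ∈ W ∪ L.toFinset by
      intro z hz
      simp only [List.toFinset_append, List.toFinset_cons, List.toFinset_nil, Finset.mem_union,
        Finset.mem_insert, Finset.notMem_empty, List.mem_toFinset, or_false] at hz
      rcases hz with hz | hz | rfl
      · exact ih (by simp [hz])
      · exact ih (by simp [hz])
      · exact hy
    by_contra hy
    simp only [Finset.mem_union, List.mem_toFinset, not_or] at hy
    have hc := Finset.card_le_card ih
    rw [h.toIsRunFrom.card_union, h'.of_append.card_union] at hc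
    have ha := h'.arr L' y [] rfl
    obtain ⟨L₁, x, L₂, rfl, hyv, hxy⟩ := h.exists_split hy.1 hy.2 (by omega)
    -- The other strategy has written more items than this one before `x`, hence one of them is
    -- written by this one at `x` or later, which contradicts the order of the other run.
    have hns : ¬ V ∪ L'.toFinset ⊆ W ∪ L₁.toFinset := by
      intro hs
      have := Finset.card_le_card hs
      rw [h.toIsRunFrom.card_union_append, h'.of_append.card_union] at this
      omega
    obtain ⟨v, hv, hv'⟩ := Finset.not_subset.1 hns
    have hvW := ih hv
    simp only [Finset.mem_union, List.mem_toFinset, not_or, List.mem_append, List.mem_cons]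
      at hv hv' hvW
    have hvL : v ∈ L' := hv.resolve_left fun h => hv'.1 (hVW h)
    have hvy : DirLE b (key v) (key y) :=
      (List.pairwise_append.1 h'.mono).2.2 v hvL y (by simp)
    have hxv : DirLE b (key x) (key v) := by
      have := (List.pairwise_append.1 h.mono).2.1
      rw [List.pairwise_cons] at this
      rcases hvW with h1 | h1 | rfl | h1
      · exact absurd h1 hv'.1
      · exact absurd h1 hv'.2
      · exact DirLE.refl _ _
      · exact this.1 v h1
    exact hxy (hxv.trans hvy)

/-- Two full runs of opposite directions from the same state, of which the one of direction `b` is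
the longer one: an item written only by the longer run comes, in direction `b`, after every item
that is written only by the shorter run. -/
theorem IsFullRun.dirLE_of_opposite {LU LD : List (Fin N)} (hU : IsFullRun M key (!b) X LU)
    (hD : IsFullRun M key b X LD) (hle : LU.length ≤ LD.length) {y z : Fin N}
    (hy : y ∈ LD) (hyU : y ∉ LU) (hz : z ∈ LU) (hzD : z ∉ LD) :
    DirLE b (key z) (key y) := by
  obtain ⟨U₁, U₂, hUz⟩ := List.append_of_mem hz
  have hza := hU.arr _ _ _ hUz
  have hzX := hU.disj z hz
  have hUl : U₁.length < LU.length := by rw [hUz]; simp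
  obtain ⟨D₁, x, D₂, hDx, hzv, hxz⟩ := hD.exists_split hzX hzD (by omega)
  by_cases hyx : y ∈ x :: D₂
  · have hm := (List.pairwise_append.1 (hDx ▸ hD.mono)).2.1
    rw [List.pairwise_cons] at hm
    have : DirLE b (key x) (key y) := by
      rcases List.mem_cons.1 hyx with rfl | h
      · exact DirLE.refl _ _
      · exact hm.1 y h
    exact (DirLE.of_not hxz).trans this
  · -- Here `y` is read before `z`, and is left behind by the shorter run, which writes `z` later.
    have hy1 : y ∈ D₁ := by
      rw [hDx] at hy
      rcases List.mem_append.1 hy with h | h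
      · exact h
      · exact absurd h hyx
    obtain ⟨E₁, E₂, hE⟩ := List.append_of_mem hy1
    have hya := hD.arr E₁ y (E₂ ++ x :: D₂) (by rw [hDx, hE]; simp)
    have hEl : E₁.length < D₁.length := by rw [hE]; simp
    obtain ⟨F₁, x', F₂, hFx, hyv, hxy⟩ :=
      hU.exists_split (hD.disj y hy) hyU (by omega)
    have hm := List.pairwise_append.1 (hFx ▸ hU.mono)
    have hzF : z ∈ x' :: F₂ := by
      by_contra hzF
      have hz1 : z ∈ F₁ := by
        rw [hFx] at hz
        rcases List.mem_append.1 hz with h | h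
        · exact h
        · exact absurd h hzF
      obtain ⟨G₁, G₂, hG⟩ := List.append_of_mem hz1
      have := hU.arr G₁ z (G₂ ++ x' :: F₂) (by rw [hFx, hG]; simp)
      have hGl : G₁.length < F₁.length := by rw [hG]; simp
      omega
    have : DirLE (!b) (key x') (key z) := by
      have hm := hm.2.1
      rw [List.pairwise_cons] at hm
      rcases List.mem_cons.1 hzF with rfl | h
      · exact DirLE.refl _ _
      · exact hm.1 z h
    exact dirLE_not.1 ((DirLE.of_not hxy).trans this)

/-- The pruning rule: after the shorter of the two full runs that are possible in a state `X`, it is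
useless to switch to the direction of the longer one, since taking the longer one twice is at least
as good. -/
theorem IsFullRun.prune {LU LD Y LDD : List (Fin N)} (hX : ∀ z ∈ X, z.val < X.card + M)
    (hU : IsFullRun M key (!b) X LU) (hD : IsFullRun M key b X LD)
    (hle : LU.length ≤ LD.length) (hY : IsRunFrom M key b (X ∪ LU.toFinset) Y)
    (hDD : IsFullRun M key b (X ∪ LD.toFinset) LDD) :
    X ∪ LU.toFinset ∪ Y.toFinset ⊆ X ∪ LD.toFinset ∪ LDD.toFinset := by
  have hcU := hU.toIsRunFrom.card_union
  have hcD := hD.toIsRunFrom.card_union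
  induction Y using List.reverseRecOn with
  | nil =>
    simp only [List.toFinset_nil, Finset.union_empty]
    refine hDD.subset_of_card_le ?_ (by omega)
    intro z hz
    rcases Finset.mem_union.1 hz with h | h
    · have := hX z h; omega
    · obtain ⟨U₁, U₂, e⟩ := List.append_of_mem (List.mem_toFinset.1 h)
      have := hU.arr _ _ _ e
      have hl : U₁.length < LU.length := by rw [e]; simp
      omega
  | append_singleton Y y ih =>
    have ih := ih hY.of_append
    suffices hy : y ∈ X ∪ LD.toFinset ∪ LDD.toFinset by
      intro z hz
      rw [List.toFinset_append, ← Finset.union_assoc, Finset.mem_union] at hz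
      rcases hz with hz | hz
      · exact ih hz
      · have : z = y := by simpa using hz
        exact this ▸ hy
    by_contra hy
    have hc := Finset.card_le_card ih
    rw [hDD.toIsRunFrom.card_union, hY.of_append.card_union] at hc
    have ha := hY.arr Y y [] rfl
    rw [Finset.mem_union, not_or, List.mem_toFinset] at hy
    obtain ⟨L₁, x, L₂, hL, hyv, hxy⟩ := hDD.exists_split hy.1 hy.2 (by omega)
    have hmY : ∀ v ∈ Y, DirLE b (key v) (key y) := fun v hv =>
      (List.pairwise_append.1 hY.mono).2.2 v hv y (by simp)
    have hm := (List.pairwise_append.1 (hL ▸ hDD.mono)).2.1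
    rw [List.pairwise_cons] at hm
    have hxv : ∀ v ∈ x :: L₂, DirLE b (key x) (key v) := by
      intro v hv
      rcases List.mem_cons.1 hv with rfl | h
      · exact DirLE.refl _ _
      · exact hm.1 v h
    have hcW : (X ∪ LD.toFinset ∪ L₁.toFinset).card = X.card + LD.length + L₁.length := by
      have h1 := hDD.toIsRunFrom
      rw [hL] at h1
      rw [h1.card_union_append, hcD]
    -- All items of `Y` are written before `x` by the strategy which takes the longer run twice.
    have hY1 : ∀ v ∈ Y, v ∈ X ∪ LD.toFinset ∪ L₁.toFinset := by
      intro v hv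
      have h1 : v ∈ X ∪ LD.toFinset ∪ LDD.toFinset := ih (by simp [hv])
      rw [Finset.mem_union, List.mem_toFinset, hL, List.mem_append] at h1
      rcases h1 with h1 | h1 | h1
      · exact Finset.mem_union_left _ h1
      · exact Finset.mem_union_right _ (by simpa using h1)
      · exact absurd ((hxv v h1).trans (hmY v hv)) hxy
    have hns : ¬ X ∪ LU.toFinset ∪ Y.toFinset ⊆ X ∪ LD.toFinset ∪ L₁.toFinset := by
      intro hs
      have := Finset.card_le_card hs
      rw [hY.of_append.card_union] at this
      omega
    obtain ⟨z, hz, hz'⟩ := Finset.not_subset.1 hns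
    have hzY : z ∉ Y := fun h => hz' (hY1 z h)
    have hzDD := ih hz
    have hzx : z ∈ x :: L₂ := by
      rw [Finset.mem_union, List.mem_toFinset, hL, List.mem_append] at hzDD
      rw [Finset.mem_union, not_or, List.mem_toFinset] at hz'
      rcases hzDD with h | h | h
      · exact absurd h hz'.1
      · exact absurd h hz'.2
      · exact h
    simp only [Finset.mem_union, List.mem_toFinset, not_or] at hz hz'
    have hzU : z ∈ LU := by
      rcases hz with (h | h) | h
      · exact absurd h hz'.1.1
      · exact h
      · exact absurd h hzY
    have hYD : ∀ v ∈ Y, v ∉ X ∪ LD.toFinset := by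
      intro v hv hvD
      have hvU := hY.disj v (by simp [hv])
      simp only [Finset.mem_union, List.mem_toFinset, not_or] at hvU hvD
      have hvD := hvD.resolve_left hvU.1
      have h1 := IsFullRun.dirLE_of_opposite hU hD hle hvD hvU.2 hzU hz'.1.2
      exact hxy (((hxv z hzx).trans h1).trans (hmY v hv))
    -- So `Y` is part of the second of the long runs, where it is too long to fit in before `x`.
    have hYL : Y.toFinset ⊆ L₁.toFinset := by
      intro v hv
      rw [List.mem_toFinset] at hv
      have h1 := hY1 v hv
      rw [Finset.mem_union] at h1
      exact h1.resolve_left (hYD v hv)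
    have h1 := Finset.card_le_card hYL
    rw [List.toFinset_card_of_nodup hY.of_append.nodup] at h1
    have h2 := List.toFinset_card_le L₁
    omega

end Combinatorics

/-! ### Heaps -/

/-- Binary trees with labels at the inner nodes, used as heaps. -/
inductive BTree (β : Type*)
  | leaf : BTree β
  | node (x : β) (l r : BTree β) : BTree β

section Heap

variable {α : Type*} [LinearOrder α] {β : Type*} (key : β → α) (b : Bool)

namespace BTree

/-- The label of the root, and `d` for a leaf. -/
def root (d : β) : BTree β → β
  | leaf => d
  | node x _ _ => x

def toList : BTree β → List β
  | leaf => []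
  | node x l r => x :: (l.toList ++ r.toList)

def depth : BTree β → ℕ
  | leaf => 0
  | node _ l r => max l.depth r.depth + 1

/-- `t` has a root, and it comes before `y` in direction `b`. -/
def Beats : BTree β → β → Prop
  | leaf, _ => False
  | node x _ _, y => DirLE b (key x) (key y)

instance (t : BTree β) (y : β) : Decidable (Beats key b t y) := by
  cases t <;> unfold Beats <;> infer_instance

/-- Heap order: the root is first in direction `b`, in every subtree. -/
def IsHeap : BTree β → Prop
  | leaf => True
  | node x l r => (∀ y ∈ l.toList ++ r.toList, DirLE b (key x) (key y)) ∧ l.IsHeap ∧ r.IsHeap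

/-- Braun trees: at every node, the left subtree has as many nodes as the right one or one more. -/
def IsBraun : BTree β → Prop
  | leaf => True
  | node _ l r => (l.toList.length = r.toList.length ∨ l.toList.length = r.toList.length + 1) ∧
      l.IsBraun ∧ r.IsBraun

/-- Insertion into a heap, which keeps Braun trees balanced. -/
def insert (y : β) : BTree β → BTree β
  | leaf => node y leaf leaf
  | node x l r =>
    if DirLE b (key x) (key y) then node x (insert y r) l else node y (insert x r) l

/-- Remove the root of a heap, by repeatedly moving up the better child. -/
def pop : BTree β → BTree β
  | leaf => leaf
  | node _ leaf r => r
  | node _ l leaf => l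
  | node _ (node x l₁ l₂) (node y r₁ r₂) =>
    if DirLE b (key x) (key y) then node x (pop (node x l₁ l₂)) (node y r₁ r₂)
    else node y (node x l₁ l₂) (pop (node y r₁ r₂))

/-- Replace the root of a heap by `y`, and let `y` sink to its place. -/
def replace (y : β) : BTree β → BTree β
  | leaf => leaf
  | node _ l r =>
    if Beats key b l y then
      if Beats key b r (l.root y) then node (r.root y) l (replace y r)
      else node (l.root y) (replace y l) r
    else
      if Beats key b r y then node (r.root y) l (replace y r)
      else node y l r

/-- The heap with the elements of a list. -/
def build (K : List β) : BTree β :=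
  K.foldr (insert key b) leaf

variable {key b}

theorem insert_perm (y : β) (t : BTree β) : (t.insert key b y).toList.Perm (y :: t.toList) := by
  induction t generalizing y with
  | leaf => simp [insert, toList]
  | node x l r ihl ihr =>
    unfold insert
    split
    · simp only [toList]
      refine (List.Perm.cons _ ((ihr y).append_right _)).trans ?_
      refine (List.Perm.swap _ _ _).trans ((List.Perm.cons _ ?_))
      exact (List.Perm.cons _ List.perm_append_comm)
    · simp only [toList]
      refine (List.Perm.cons _ ((ihr x).append_right _)).trans ?_
      refine ((List.Perm.cons _ ?_))
      exact (List.Perm.cons _ List.perm_append_comm)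

theorem build_perm (K : List β) : (build key b K).toList.Perm K := by
  induction K with
  | nil => simp [build, toList]
  | cons y K ih => exact (insert_perm y _).trans (ih.cons y)

theorem IsHeap.insert {t : BTree β} (h : t.IsHeap key b) (y : β) :
    (t.insert key b y).IsHeap key b := by
  induction t generalizing y with
  | leaf => simp [BTree.insert, IsHeap, toList]
  | node x l r ihl ihr =>
    obtain ⟨h1, h2, h3⟩ := h
    unfold BTree.insert
    split
    next hxy =>
      refine ⟨?_, ihr h3 y, h2⟩
      intro z hz
      rw [List.mem_append, (insert_perm y r).mem_iff, List.mem_cons] at hz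
      rcases hz with (rfl | hz) | hz
      · exact hxy
      · exact h1 z (by simp [hz])
      · exact h1 z (by simp [hz])
    next hxy =>
      have hyx := DirLE.of_not hxy
      refine ⟨?_, ihr h3 x, h2⟩
      intro z hz
      rw [List.mem_append, (insert_perm x r).mem_iff, List.mem_cons] at hz
      rcases hz with (rfl | hz) | hz
      · exact hyx
      · exact hyx.trans (h1 z (by simp [hz]))
      · exact hyx.trans (h1 z (by simp [hz]))

theorem isHeap_build (K : List β) : (build key b K).IsHeap key b := by
  induction K with
  | nil => trivial
  | cons y K ih => exact ih.insert y

theorem IsBraun.insert {t : BTree β} (h : t.IsBraun) (y : β) : (t.insert key b y).IsBraun := by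
  induction t generalizing y with
  | leaf => simp [BTree.insert, IsBraun, toList]
  | node x l r ihl ihr =>
    obtain ⟨h1, h2, h3⟩ := h
    unfold BTree.insert
    split
    · refine ⟨?_, ihr h3 _, h2⟩
      rw [(insert_perm _ r).length_eq, List.length_cons]
      omega
    · refine ⟨?_, ihr h3 _, h2⟩
      rw [(insert_perm _ r).length_eq, List.length_cons]
      omega

theorem isBraun_build (K : List β) : (build key b K).IsBraun := by
  induction K with
  | nil => trivial
  | cons y K ih => exact ih.insert y

theorem IsBraun.depth_le {t : BTree β} (h : t.IsBraun) :
    t.depth ≤ Nat.log 2 t.toList.length + 1 := by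
  induction t with
  | leaf => simp [depth]
  | node x l r ihl ihr =>
    obtain ⟨h1, h2, h3⟩ := h
    by_cases h0 : l.toList.length = 0
    · have hl : l = leaf := by cases l <;> simp_all [toList]
      have hr : r = leaf := by cases r <;> simp_all [toList]
      simp [hl, hr, depth]
    · have e : (node x l r).toList.length = l.toList.length + r.toList.length + 1 := by
        simp [toList]
      have h4 := Nat.log_mono_right (b := 2)
        (show l.toList.length ≤ (node x l r).toList.length / 2 by omega)
      have h5 := Nat.log_mono_right (b := 2)
        (show r.toList.length ≤ (node x l r).toList.length / 2 by omega)
      have h6 : Nat.log 2 ((node x l r).toList.length / 2) + 1 =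
          Nat.log 2 (node x l r).toList.length := by
        rw [Nat.log_div_base]
        have := Nat.log_pos (b := 2) (n := (node x l r).toList.length) (by norm_num) (by omega)
        omega
      have := ihl h2
      have := ihr h3
      simp only [depth]
      omega

theorem depth_build_le (K : List β) : (build key b K).depth ≤ Nat.log 2 K.length + 1 := by
  have := (isBraun_build (key := key) (b := b) K).depth_le
  rwa [(build_perm K).length_eq] at this

theorem pop_perm (x : β) (l r : BTree β) :
    ((node x l r).pop key b).toList.Perm (l.toList ++ r.toList) := by
  suffices h : ∀ t : BTree β, ∀ x l r, t = node x l r →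
      (t.pop key b).toList.Perm (l.toList ++ r.toList) from h _ _ _ _ rfl
  intro t
  induction t with
  | leaf => intro x l r h; cases h
  | node x l r ihl ihr =>
    intro _ _ _ h
    cases h
    cases l with
    | leaf => simp [pop, toList]
    | node y l₁ l₂ =>
      cases r with
      | leaf => simp [pop, toList]
      | node z r₁ r₂ =>
        unfold pop
        split
        · have := ihl _ _ _ rfl
          simp only [toList] at this ⊢
          exact (this.append_right _).cons _
        · have := ihr _ _ _ rfl
          simp only [toList] at this ⊢
          refine ((this.append_left _).cons _).trans ?_
          exact (List.perm_middle (l₁ := y :: (l₁.toList ++ l₂.toList))).symm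

theorem depth_pop_le (t : BTree β) : (t.pop key b).depth ≤ t.depth := by
  induction t with
  | leaf => simp [pop]
  | node x l r ihl ihr =>
    cases l with
    | leaf => simp only [pop, depth]; omega
    | node y l₁ l₂ =>
      cases r with
      | leaf => simp only [pop, depth]; omega
      | node z r₁ r₂ =>
        unfold pop
        split
        · simp only [depth] at *; omega
        · simp only [depth] at *; omega

theorem IsHeap.pop {t : BTree β} (h : t.IsHeap key b) : (t.pop key b).IsHeap key b := by
  induction t with
  | leaf => exact h
  | node x l r ihl ihr =>
    obtain ⟨h1, h2, h3⟩ := h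
    cases l with
    | leaf => exact h3
    | node y l₁ l₂ =>
      cases r with
      | leaf => exact h2
      | node z r₁ r₂ =>
        unfold BTree.pop
        split
        next hyz =>
          refine ⟨?_, ihl h2, h3⟩
          intro w hw
          rw [List.mem_append, (pop_perm _ _ _).mem_iff] at hw
          rcases hw with hw | hw
          · exact h2.1 w hw
          · rcases List.mem_cons.1 hw with rfl | hw
            · exact hyz
            · exact hyz.trans (h3.1 w hw)
        next hyz =>
          have hzy := DirLE.of_not hyz
          refine ⟨?_, h2, ihr h3⟩
          intro w hw
          rw [List.mem_append, (pop_perm _ _ _).mem_iff] at hw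
          rcases hw with hw | hw
          · rcases List.mem_cons.1 hw with rfl | hw
            · exact hzy
            · exact hzy.trans (h2.1 w hw)
          · exact h3.1 w hw

theorem replace_perm (x y : β) (l r : BTree β) :
    ((node x l r).replace key b y).toList.Perm (y :: (l.toList ++ r.toList)) := by
  suffices h : ∀ t : BTree β, ∀ x l r, t = node x l r →
      (t.replace key b y).toList.Perm (y :: (l.toList ++ r.toList)) from h _ _ _ _ rfl
  intro t
  induction t with
  | leaf => intro x l r h; cases h
  | node x l r ihl ihr =>
    intro _ _ _ h
    cases h
    have hR : ∀ z, Beats key b r z →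
        (node (r.root y) l (r.replace key b y)).toList.Perm (y :: (l.toList ++ r.toList)) := by
      intro z hz
      cases r with
      | leaf => exact absurd hz (by simp [Beats])
      | node w r₁ r₂ =>
        have := ihr _ _ _ rfl
        simp only [toList, root] at this ⊢
        refine ((this.append_left _).cons _).trans ?_
        refine (List.perm_middle.cons _).trans ((List.Perm.swap _ _ _).trans (List.Perm.cons _ ?_))
        exact List.perm_middle.symm
    unfold replace
    split_ifs with h1 h2 h2
    · exact hR _ h2
    · cases l with
      | leaf => exact absurd h1 (by simp [Beats])
      | node w l₁ l₂ =>
        have := ihl _ _ _ rfl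
        simp only [toList, root] at this ⊢
        exact ((this.append_right _).cons _).trans (List.Perm.swap _ _ _)
    · exact hR _ h2
    · exact List.Perm.refl _

theorem depth_replace_le (y : β) (t : BTree β) : (t.replace key b y).depth ≤ t.depth := by
  induction t with
  | leaf => simp [replace]
  | node x l r ihl ihr =>
    unfold replace
    split_ifs <;> simp only [depth] <;> omega

theorem IsHeap.root_le {t : BTree β} (h : t.IsHeap key b) (d : β) {y : β} (hy : y ∈ t.toList) :
    DirLE b (key (t.root d)) (key y) := by
  cases t with
  | leaf => simp [toList] at hy
  | node x l r =>
    rcases List.mem_cons.1 hy with rfl | hy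
    · exact DirLE.refl _ _
    · exact h.1 y hy

theorem not_beats_iff_forall {t : BTree β} (h : t.IsHeap key b) {y : β} (hy : ¬ t.Beats key b y) :
    ∀ z ∈ t.toList, DirLE b (key y) (key z) := by
  intro z hz
  cases t with
  | leaf => simp [toList] at hz
  | node x l r => exact (DirLE.of_not hy).trans (h.root_le x hz)

theorem Beats.root_le {t : BTree β} {y : β} (h : t.Beats key b y) (d : β) :
    DirLE b (key (t.root d)) (key y) := by
  cases t with
  | leaf => exact h.elim
  | node x l r => exact h

theorem mem_replace {y z : β} {t : BTree β} (h : z ∈ (t.replace key b y).toList) :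
    z = y ∨ z ∈ t.toList := by
  cases t with
  | leaf => simp [replace, toList] at h
  | node x l r =>
    rw [(replace_perm x y l r).mem_iff, List.mem_cons] at h
    exact h.imp_right fun h => List.mem_cons_of_mem _ h

theorem IsHeap.replace {t : BTree β} (h : t.IsHeap key b) (y : β) :
    (t.replace key b y).IsHeap key b := by
  induction t with
  | leaf => exact h
  | node x l r ihl ihr =>
    obtain ⟨h1, h2, h3⟩ := h
    unfold BTree.replace
    split_ifs with hl hr hr
    · refine ⟨?_, h2, ihr h3⟩
      intro w hw
      rcases List.mem_append.1 hw with hw | hw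
      · have := hr.root_le y
        exact this.trans (h2.root_le y hw)
      · rcases mem_replace hw with rfl | hw
        · exact (hr.root_le w).trans (hl.root_le w)
        · exact h3.root_le y hw
    · refine ⟨?_, ihl h2, h3⟩
      intro w hw
      rcases List.mem_append.1 hw with hw | hw
      · rcases mem_replace hw with rfl | hw
        · exact hl.root_le w
        · exact h2.root_le y hw
      · exact not_beats_iff_forall h3 hr w hw
    · refine ⟨?_, h2, ihr h3⟩
      intro w hw
      rcases List.mem_append.1 hw with hw | hw
      · exact (hr.root_le y).trans (not_beats_iff_forall h2 hl w hw)
      · rcases mem_replace hw with rfl | hw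
        · exact hr.root_le w
        · exact h3.root_le y hw
    · refine ⟨?_, h2, h3⟩
      intro w hw
      rcases List.mem_append.1 hw with hw | hw
      · exact not_beats_iff_forall h2 hl w hw
      · exact not_beats_iff_forall h3 hr w hw

end BTree

end Heap

/-! ### Greedy runs -/

section Greedy

variable {α : Type*} {β : Type*}

theorem Writes.perm {B B' J S : List α} (h : Writes B J S) (hB : B.Perm B') : Writes B' J S := by
  induction h generalizing B' with
  | done => rw [List.nil_perm.1 hB]; exact Writes.done
  | write l r J S a _ ih =>
    have ha : a ∈ B' := hB.mem_iff.1 (by simp)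
    obtain ⟨l', r', rfl⟩ := List.append_of_mem ha
    refine Writes.write l' r' J S a (ih (List.Perm.append_right _ ?_))
    exact ((List.perm_middle.symm.trans hB).trans List.perm_middle).cons_inv

/-- The state of the algorithm: the items written so far (latest first), the buffer and the unread
part of the input. -/
structure State (β : Type*) where
  acc : List β
  buf : List β
  rest : List β

variable [LinearOrder α] (key : β → α) (b : Bool)

/-- The loop of a greedy run of direction `b`.  The buffer is divided into a heap, which holds the
items that can still be written in this run, and the list `K` of the items that cannot. -/
def runLoop (t : BTree β) (J K acc : List β) : State β :=
  match t, J with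
  | .leaf, J => ⟨acc, K, J⟩
  | .node x l r, [] => runLoop (BTree.pop key b (.node x l r)) [] K (x :: acc)
  | .node x l r, y :: J =>
    if DirLE b (key x) (key y) then runLoop (BTree.replace key b y (.node x l r)) J K (x :: acc)
    else runLoop (BTree.pop key b (.node x l r)) J (y :: K) (x :: acc)
termination_by t.toList.length + J.length
decreasing_by
  · rw [(BTree.pop_perm x l r).length_eq]; simp [BTree.toList]
  · rw [(BTree.replace_perm x y l r).length_eq]; simp [BTree.toList]
  · rw [(BTree.pop_perm x l r).length_eq]; simp [BTree.toList]; omega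

/-- A greedy run of direction `b` from a state. -/
def run (s : State β) : State β :=
  runLoop key b (BTree.build key b s.buf) s.rest [] s.acc

/-- What a greedy run achieves: starting from unread input `J` and a buffer which consists of the
eligible items `H` and the other items `K`, it writes `out` and ends with buffer `K'` and unread
input `J'`. -/
structure GreedySpec (H J K out K' J' : List β) : Prop where
  rest : J' = J.drop out.length
  perm : (H ++ K ++ J.take out.length).Perm (out ++ K')
  sub : ∀ z ∈ H, z ∈ out
  arr : ∀ L₁ x L₂, out = L₁ ++ x :: L₂ → x ∈ H ++ J.take L₁.length
  mono : out.Pairwise fun x y => DirLE b (key x) (key y)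
  lower : ∀ c, (∀ z ∈ H, DirLE b c (key z)) → ∀ z ∈ out, DirLE b c (key z)
  full : ∀ L₁ x L₂, out = L₁ ++ x :: L₂ → ∀ z, J[L₁.length]? = some z → z ∉ out →
    ¬ DirLE b (key x) (key z)
  writes : ∀ S, Writes (K'.map key) (J'.map key) S →
    Writes ((H ++ K).map key) (J.map key) (out.map key ++ S)

variable {key b}
variable {H H' J K out K' J' : List β} {x y : β}

theorem GreedySpec.nil (K J : List β) : GreedySpec key b [] J K [] K J where
  rest := by simp
  perm := by simp
  sub := by simp
  arr := by simp
  mono := by simp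
  lower := by simp
  full := by simp
  writes := by simp

/-- A step of a greedy run in which nothing is read since the input is used up. -/
theorem GreedySpec.flush (hH : H.Perm (x :: H')) (hx : ∀ z ∈ H', DirLE b (key x) (key z))
    (h : GreedySpec key b H' [] K out K' J') : GreedySpec key b H [] K (x :: out) K' J' where
  rest := by simpa using h.rest
  perm := by
    have := h.perm
    simp only [List.take_nil, List.append_nil, List.cons_append] at this ⊢
    exact (hH.append_right _).trans (this.cons x)
  sub z hz := by
    rcases List.mem_cons.1 (hH.mem_iff.1 hz) with rfl | hz
    · simp
    · simp [h.sub z hz]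
  arr L₁ w L₂ e := by
    cases L₁ with
    | nil =>
      obtain ⟨rfl, rfl⟩ := List.cons.inj e
      simp [hH.mem_iff]
    | cons w' L₁ =>
      obtain ⟨rfl, e'⟩ := List.cons.inj e
      have := h.arr L₁ w L₂ e'
      simp only [List.take_nil, List.append_nil] at this ⊢
      simp [hH.mem_iff, this]
  mono := List.pairwise_cons.2 ⟨h.lower _ hx, h.mono⟩
  lower c hc z hz := by
    rcases List.mem_cons.1 hz with rfl | hz
    · exact hc _ (hH.mem_iff.2 (by simp))
    · exact h.lower c (fun w hw => hc w (hH.mem_iff.2 (by simp [hw]))) z hz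
  full := by simp
  writes S hS := by
    have h1 := h.writes S hS
    have h2 := Writes.write [] ((H' ++ K).map key) [] (out.map key ++ S) (key x) (by simpa using h1)
    simp only [List.nil_append] at h2
    refine h2.perm ?_
    exact ((hH.append_right K).map key).symm

/-- A step of a greedy run in which the item that is read is eligible for the run. -/
theorem GreedySpec.take (hH : H.Perm (x :: H')) (hx : ∀ z ∈ H', DirLE b (key x) (key z))
    (hxy : DirLE b (key x) (key y)) (h : GreedySpec key b (y :: H') J K out K' J') :
    GreedySpec key b H (y :: J) K (x :: out) K' J' where
  rest := by simpa using h.rest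
  perm := by
    have := h.perm
    simp only [List.length_cons, List.take_succ_cons, List.cons_append] at this ⊢
    refine List.perm_middle.trans ?_
    refine (List.Perm.cons y ((hH.append_right _).append_right _)).trans ?_
    exact (List.Perm.swap _ _ _).trans (this.cons x)
  sub z hz := by
    rcases List.mem_cons.1 (hH.mem_iff.1 hz) with rfl | hz
    · simp
    · simp [h.sub z (by simp [hz])]
  arr L₁ w L₂ e := by
    cases L₁ with
    | nil =>
      obtain ⟨rfl, rfl⟩ := List.cons.inj e
      simp [hH.mem_iff]
    | cons w' L₁ =>
      obtain ⟨rfl, e'⟩ := List.cons.inj e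
      have := h.arr L₁ w L₂ e'
      simp only [List.length_cons, List.take_succ_cons, List.mem_append, List.mem_cons,
        hH.mem_iff] at this ⊢
      tauto
  mono := List.pairwise_cons.2 ⟨h.lower _ (by simpa using ⟨hxy, hx⟩), h.mono⟩
  lower c hc z hz := by
    have hcx : DirLE b c (key x) := hc _ (hH.mem_iff.2 (by simp))
    rcases List.mem_cons.1 hz with rfl | hz
    · exact hcx
    · refine h.lower c (fun w hw => ?_) z hz
      rcases List.mem_cons.1 hw with rfl | hw
      · exact hcx.trans hxy
      · exact hc w (hH.mem_iff.2 (by simp [hw]))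
  full L₁ w L₂ e z hz hzo := by
    cases L₁ with
    | nil =>
      simp only [List.length_nil, List.getElem?_cons_zero, Option.some.injEq] at hz
      subst hz
      exact absurd (List.mem_cons_of_mem _ (h.sub y (by simp))) hzo
    | cons w' L₁ =>
      obtain ⟨rfl, e'⟩ := List.cons.inj e
      exact h.full L₁ w L₂ e' z (by simpa using hz) (fun h => hzo (by simp [h]))
  writes S hS := by
    have h1 := h.writes S hS
    have h2 := Writes.write [] ((H' ++ K).map key) ((y :: J).map key) (out.map key ++ S) (key x)
      (by
        refine Writes.perm (by simpa using h1) ?_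
        simpa using (List.perm_append_singleton (key y) (H'.map key ++ K.map key)).symm)
    simp only [List.nil_append] at h2
    refine h2.perm ?_
    exact ((hH.append_right K).map key).symm

/-- A step of a greedy run in which the item that is read is not eligible for the run. -/
theorem GreedySpec.skip (hH : H.Perm (x :: H')) (hx : ∀ z ∈ H', DirLE b (key x) (key z))
    (hxy : ¬ DirLE b (key x) (key y)) (h : GreedySpec key b H' J (y :: K) out K' J') :
    GreedySpec key b H (y :: J) K (x :: out) K' J' where
  rest := by simpa using h.rest
  perm := by
    have := h.perm
    simp only [List.length_cons, List.take_succ_cons, List.cons_append] at this ⊢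
    refine (List.Perm.append_right _ (hH.append_right _)).trans ?_
    simp only [List.cons_append]
    refine List.Perm.cons x (List.Perm.trans ?_ this)
    refine List.perm_middle.trans ?_
    exact (List.Perm.append_right _ List.perm_middle).symm
  sub z hz := by
    rcases List.mem_cons.1 (hH.mem_iff.1 hz) with rfl | hz
    · simp
    · simp [h.sub z hz]
  arr L₁ w L₂ e := by
    cases L₁ with
    | nil =>
      obtain ⟨rfl, rfl⟩ := List.cons.inj e
      simp [hH.mem_iff]
    | cons w' L₁ =>
      obtain ⟨rfl, e'⟩ := List.cons.inj e
      have := h.arr L₁ w L₂ e'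
      simp only [List.length_cons, List.take_succ_cons, List.mem_append, List.mem_cons,
        hH.mem_iff] at this ⊢
      tauto
  mono := List.pairwise_cons.2 ⟨h.lower _ hx, h.mono⟩
  lower c hc z hz := by
    rcases List.mem_cons.1 hz with rfl | hz
    · exact hc _ (hH.mem_iff.2 (by simp))
    · exact h.lower c (fun w hw => hc w (hH.mem_iff.2 (by simp [hw]))) z hz
  full L₁ w L₂ e z hz hzo := by
    cases L₁ with
    | nil =>
      obtain ⟨rfl, rfl⟩ := List.cons.inj e
      simp only [List.length_nil, List.getElem?_cons_zero, Option.some.injEq] at hz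
      exact hz ▸ hxy
    | cons w' L₁ =>
      obtain ⟨rfl, e'⟩ := List.cons.inj e
      exact h.full L₁ w L₂ e' z (by simpa using hz) (fun h => hzo (by simp [h]))
  writes S hS := by
    have h1 := h.writes S hS
    have h2 := Writes.write [] ((H' ++ K).map key) ((y :: J).map key) (out.map key ++ S) (key x)
      (by
        refine Writes.perm (by simpa using h1) ?_
        simp only [List.map_append, List.map_cons, List.nil_append, List.take_succ_cons,
          List.take_zero]
        exact List.perm_middle.trans (List.perm_append_singleton _ _).symm)
    simp only [List.nil_append] at h2
    refine h2.perm ?_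
    exact ((hH.append_right K).map key).symm

theorem GreedySpec.of_perm (h : GreedySpec key b H J K out K' J') (hp : H.Perm H') :
    GreedySpec key b H' J K out K' J' :=
  { h with
    perm := ((hp.symm.append_right _).append_right _).trans h.perm
    sub := fun z hz => h.sub z (hp.mem_iff.2 hz)
    arr := fun L₁ w L₂ e => by
      have := h.arr L₁ w L₂ e
      rwa [List.mem_append, hp.mem_iff, ← List.mem_append] at this
    lower := fun c hc => h.lower c fun z hz => hc z (hp.mem_iff.1 hz)
    writes := fun S hS => (h.writes S hS).perm ((hp.append_right _).map key) }

theorem runLoop_spec (t : BTree β) (ht : t.IsHeap key b) (J K acc : List β) :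
    ∃ out, (runLoop key b t J K acc).acc = out.reverse ++ acc ∧
      GreedySpec key b t.toList J K out (runLoop key b t J K acc).buf
        (runLoop key b t J K acc).rest := by
  fun_induction runLoop key b t J K acc with
  | case1 K acc J => exact ⟨[], by simp, .nil _ _⟩
  | case2 K acc x l r ih =>
    obtain ⟨out, h1, h2⟩ := ih ht.pop
    refine ⟨x :: out, by simp [h1], .flush (H' := _) ?_ ?_ h2⟩
    · exact ((BTree.pop_perm x l r).cons x).symm
    · intro z hz
      exact ht.1 z ((BTree.pop_perm x l r).mem_iff.1 hz)
  | case3 K acc x l r y J hxy ih =>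
    obtain ⟨out, h1, h2⟩ := ih (ht.replace y)
    refine ⟨x :: out, by simp [h1],
      .take (H' := l.toList ++ r.toList) (List.Perm.refl _) ht.1 hxy ?_⟩
    exact h2.of_perm (BTree.replace_perm x y l r)
  | case4 K acc x l r y J hxy ih =>
    obtain ⟨out, h1, h2⟩ := ih ht.pop
    refine ⟨x :: out, by simp [h1], .skip (H' := _) ?_ ?_ hxy h2⟩
    · exact ((BTree.pop_perm x l r).cons x).symm
    · intro z hz
      exact ht.1 z ((BTree.pop_perm x l r).mem_iff.1 hz)

theorem run_spec (s : State β) :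
    ∃ out, (run key b s).acc = out.reverse ++ s.acc ∧
      GreedySpec key b s.buf s.rest [] out (run key b s).buf (run key b s).rest := by
  obtain ⟨out, h1, h2⟩ := runLoop_spec (key := key) (b := b) _ (BTree.isHeap_build s.buf)
    s.rest [] s.acc
  exact ⟨out, h1, h2.of_perm (BTree.build_perm s.buf)⟩

end Greedy

/-! ### Searching for a good sequence of directions -/

section Search

variable {α : Type*} [LinearOrder α] {N : ℕ}

/-- The set of items that have been written in a state. -/
def State.written (s : State (Fin N)) : Finset (Fin N) :=
  Finset.univ \ (s.buf ++ s.rest).toFinset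

/-- The states of the algorithm: the unread items are the last ones, all but `M` of the items that
have been read are written, and `c` of them were written before `s.acc`. -/
structure State.Valid (M c : ℕ) (s : State (Fin N)) : Prop where
  nodup : (s.buf ++ s.rest).Nodup
  rest_eq : s.rest = (List.finRange N).drop (s.written.card + M)
  buf_lt : ∀ z ∈ s.buf, z.val < s.written.card + M
  card_eq : s.written.card = c + s.acc.length

theorem mem_take_drop_finRange {k i : ℕ} {z : Fin N}
    (h : z ∈ ((List.finRange N).drop k).take i) : z.val < k + i := by
  obtain ⟨j, hj, rfl⟩ := List.mem_iff_getElem.1 h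
  have : j < i := by simp at hj; omega
  simpa using this

theorem le_of_mem_drop_finRange {k : ℕ} {z : Fin N} (h : z ∈ (List.finRange N).drop k) :
    k ≤ z.val := by
  obtain ⟨j, hj, rfl⟩ := List.mem_iff_getElem.1 h
  simp

variable {M c c' k : ℕ} {key : Fin N → α} {b : Bool} {s s' : State (Fin N)}

theorem State.mem_written {z : Fin N} : z ∈ s.written ↔ z ∉ s.buf ∧ z ∉ s.rest := by
  simp [State.written]

theorem State.card_written (h : (s.buf ++ s.rest).Nodup) :
    s.written.card + s.buf.length + s.rest.length = N := by
  have h1 := Finset.card_sdiff_add_card_eq_card (Finset.subset_univ (s.buf ++ s.rest).toFinset)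
  rw [List.toFinset_card_of_nodup h, Finset.card_univ, Fintype.card_fin, List.length_append] at h1
  unfold State.written
  omega

theorem State.Valid.lt_of_mem (h : s.Valid M c) : ∀ z ∈ s.written, z.val < s.written.card + M := by
  intro z hz
  by_contra hlt
  refine (State.mem_written.1 hz).2 ?_
  rw [h.rest_eq, List.mem_iff_getElem]
  exact ⟨z.val - (s.written.card + M), by simp; omega, by ext; simp; omega⟩

theorem State.Valid.run (h : s.Valid M c) (key : Fin N → α) (b : Bool) :
    ∃ out, (run key b s).acc = out.reverse ++ s.acc ∧ IsFullRun M key b s.written out ∧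
      (run key b s).written = s.written ∪ out.toFinset ∧ (run key b s).Valid M c ∧
      ∀ S, Writes ((run key b s).buf.map key) ((run key b s).rest.map key) S →
        Writes (s.buf.map key) (s.rest.map key) (out.map key ++ S) := by
  obtain ⟨out, hacc, hg⟩ := run_spec (key := key) (b := b) s
  set s' := RunGen.run key b s
  have hperm : (s.buf ++ s.rest).Perm (out ++ (s'.buf ++ s'.rest)) := by
    have h1 := hg.perm.append_right (s.rest.drop out.length)
    rw [← hg.rest] at h1
    rw [List.append_nil, List.append_assoc, hg.rest, List.take_append_drop] at h1
    rw [hg.rest]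
    simpa using h1
  have hnd := hperm.nodup_iff.1 h.nodup
  have hw : s'.written = s.written ∪ out.toFinset := by
    ext z
    have h1 := hperm.mem_iff (a := z)
    have h2 := List.disjoint_of_nodup_append hnd
    have h3 : z ∈ out → z ∉ s'.buf ++ s'.rest := fun ha hb => h2 ha hb
    simp only [List.mem_append] at h1 h3
    simp only [State.mem_written, Finset.mem_union, List.mem_toFinset]
    tauto
  have hfull : IsFullRun M key b s.written out :=
    { nodup := hnd.of_append_left
      disj := fun x hx hx' => by
        have h1 := hperm.mem_iff.2 (List.mem_append_left _ hx)
        rw [List.mem_append] at h1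
        have := State.mem_written.1 hx'
        tauto
      arr := fun L₁ x L₂ e => by
        have h1 := hg.arr L₁ x L₂ e
        rw [List.mem_append] at h1
        rcases h1 with h1 | h1
        · have := h.buf_lt x h1; omega
        · rw [h.rest_eq] at h1
          have := mem_take_drop_finRange h1
          omega
      mono := hg.mono
      init := fun z hz => by
        by_cases hzb : z ∈ s.buf
        · exact Or.inr (hg.sub z hzb)
        · refine Or.inl (State.mem_written.2 ⟨hzb, fun hzr => ?_⟩)
          rw [h.rest_eq] at hzr
          have := le_of_mem_drop_finRange hzr
          omega
      full := fun L₁ x L₂ e z _ hz' hv => by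
        refine hg.full L₁ x L₂ e z ?_ hz'
        rw [h.rest_eq, List.getElem?_drop, ← hv, List.getElem?_eq_getElem (by simp)]
        simp }
  have hcard : s'.written.card = s.written.card + out.length := by
    rw [hw, hfull.toIsRunFrom.card_union]
  refine ⟨out, hacc, hfull, hw, ⟨hnd.of_append_right, ?_, ?_, ?_⟩, ?_⟩
  · rw [hg.rest, h.rest_eq, List.drop_drop, hcard]
    congr 1
    omega
  · intro z hz
    have h1 := hg.perm.mem_iff.2 (List.mem_append_right _ hz)
    rw [List.append_nil, List.mem_append] at h1
    rcases h1 with h1 | h1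
    · have := h.buf_lt z h1; omega
    · rw [h.rest_eq] at h1
      have := mem_take_drop_finRange h1
      omega
  · rw [hcard, hacc, h.card_eq]
    simp
    omega
  · intro S hS
    simpa using hg.writes S hS

variable (key) in
/-- Greedy runs of the given directions, one after the other. -/
def runList (ds : List Bool) (s : State (Fin N)) : State (Fin N) :=
  ds.foldl (fun s b => run key b s) s

theorem runList_append (ds ds' : List Bool) (s : State (Fin N)) :
    runList key (ds ++ ds') s = runList key ds' (runList key ds s) := by
  simp [runList]

theorem State.Valid.valid_run (h : s.Valid M c) (key : Fin N → α) (b : Bool) :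
    (RunGen.run key b s).Valid M c := by
  obtain ⟨_, _, _, _, h, _⟩ := h.run key b
  exact h

theorem State.Valid.valid_runList (h : s.Valid M c) (key : Fin N → α) (ds : List Bool) :
    (runList key ds s).Valid M c := by
  induction ds generalizing s with
  | nil => exact h
  | cons d ds ih => exact ih (h.valid_run key d)

theorem State.Valid.written_subset_run (h : s.Valid M c) (key : Fin N → α) (b : Bool) :
    s.written ⊆ (RunGen.run key b s).written := by
  obtain ⟨_, _, _, hw, _⟩ := h.run key b
  rw [hw]
  exact Finset.subset_union_left

theorem written_run_mono (h : s.Valid M c) (h' : s'.Valid M c') (hs : s.written ⊆ s'.written) :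
    (run key b s).written ⊆ (run key b s').written := by
  obtain ⟨_, _, hf, hw, _⟩ := h.run key b
  obtain ⟨_, _, hf', hw', _⟩ := h'.run key b
  rw [hw, hw']
  exact hf'.mono_state hf.toIsRunFrom hs

theorem written_runList_mono (h : s.Valid M c) (h' : s'.Valid M c') (hs : s.written ⊆ s'.written)
    (ds : List Bool) : (runList key ds s).written ⊆ (runList key ds s').written := by
  induction ds generalizing s s' with
  | nil => exact hs
  | cons d ds ih => exact ih (h.valid_run key d) (h'.valid_run key d) (written_run_mono h h' hs)

variable (key) in
/-- The direction in which the greedy run is longer. -/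
def longDir {β : Type*} (key : β → α) (s : State β) : Bool :=
  decide ((run key false s).acc.length < (run key true s).acc.length)

theorem length_run_le_longDir (s : State (Fin N)) (b : Bool) :
    (run key b s).acc.length ≤ (run key (longDir key s) s).acc.length := by
  by_cases h : (run key false s).acc.length < (run key true s).acc.length
  · cases b <;> simp [longDir, h, h.le]
  · cases b <;> simp [longDir, h]
    exact not_lt.1 h

theorem written_prune (h : s.Valid M c) :
    (run key (longDir key s) (run key (!longDir key s) s)).written ⊆
      (run key (longDir key s) (run key (longDir key s) s)).written := by
  have hlen := length_run_le_longDir (key := key) s (!longDir key s)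
  generalize longDir key s = b at *
  obtain ⟨LU, haU, hfU, hwU, hvU, _⟩ := h.run key (!b)
  obtain ⟨LD, haD, hfD, hwD, hvD, _⟩ := h.run key b
  obtain ⟨Y, _, hfY, hwY, _⟩ := hvU.run key b
  obtain ⟨Z, _, hfZ, hwZ, _⟩ := hvD.run key b
  rw [hwY, hwZ, hwU, hwD]
  rw [hwU] at hfY
  rw [hwD] at hfZ
  rw [haU, haD] at hlen
  exact hfU.prune h.lt_of_mem hfD (by simpa using hlen) hfY.toIsRunFrom hfZ

variable (key) in
/-- The best state that can be reached with `k` runs.  If the first run is not in the longer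
direction, then only its repetition is considered as the second run, so that the number of
possibilities is a Fibonacci number. -/
def search {β : Type*} (key : β → α) : ℕ → State β → State β
  | 0, s => s
  | 1, s => run key (longDir key s) s
  | k + 2, s =>
    if (search key k (run key (!longDir key s) (run key (!longDir key s) s))).acc.length ≤
        (search key (k + 1) (run key (longDir key s) s)).acc.length then
      search key (k + 1) (run key (longDir key s) s)
    else search key k (run key (!longDir key s) (run key (!longDir key s) s))

theorem exists_search_eq (k : ℕ) (s : State (Fin N)) :
    ∃ ds, ds.length = k ∧ search key k s = runList key ds s := by
  fun_induction search key k s with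
  | case1 s => exact ⟨[], rfl, rfl⟩
  | case2 s => exact ⟨[longDir key s], rfl, rfl⟩
  | case3 k s _ _ ih1 =>
    obtain ⟨ds, h1, h2⟩ := ih1
    exact ⟨longDir key s :: ds, by simp [h1], h2⟩
  | case4 k s _ ih2 _ =>
    obtain ⟨ds, h1, h2⟩ := ih2
    exact ⟨(!longDir key s) :: (!longDir key s) :: ds, by simp [h1], h2⟩

theorem State.Valid.valid_search (h : s.Valid M c) (key : Fin N → α) (k : ℕ) :
    (search key k s).Valid M c := by
  obtain ⟨ds, -, h2⟩ := exists_search_eq (key := key) k s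
  exact h2 ▸ h.valid_runList key ds

theorem card_runList_le_search (k : ℕ) (s : State (Fin N)) (h : s.Valid M c) (ds : List Bool)
    (hds : ds.length = k) :
    (runList key ds s).written.card ≤ (search key k s).written.card := by
  induction k using Nat.strong_induction_on generalizing s ds with
  | _ k ih =>
    match k, ih, ds, hds with
    | 0, _, [], _ => exact le_rfl
    | 1, _, [d], _ =>
      have h1 := (h.valid_run key d).card_eq
      have h2 := (h.valid_run key (longDir key s)).card_eq
      have h3 := length_run_le_longDir (key := key) s d
      change (run key d s).written.card ≤ (run key (longDir key s) s).written.card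
      omega
    | k + 2, ih, d :: d' :: ds, hds =>
      have hk : ds.length = k := by simpa using hds
      have hl := h.valid_run key (longDir key s)
      have hs := h.valid_run key (!longDir key s)
      have hss := hs.valid_run key (!longDir key s)
      have hp : (search key (k + 1) (run key (longDir key s) s)).written.card ≤
            (search key (k + 2) s).written.card ∧
          (search key k (run key (!longDir key s) (run key (!longDir key s) s))).written.card ≤
            (search key (k + 2) s).written.card := by
        have h1 := (hl.valid_search key (k + 1)).card_eq
        have h2 := (hss.valid_search key k).card_eq
        rw [search]
        split_ifs
        · exact ⟨le_rfl, by omega⟩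
        · exact ⟨by omega, le_rfl⟩
      by_cases hd : d = longDir key s
      · have := ih (k + 1) (by omega) _ hl (d' :: ds) (by simp [hk])
        rw [← hd] at hp this
        exact this.trans hp.1
      · have hd : d = !longDir key s := by
          cases d <;> cases h : longDir key s <;> simp_all
        by_cases hd' : d' = longDir key s
        · have h1 := ih (k + 1) (by omega) _ hl (d' :: ds) (by simp [hk])
          have h2 : (runList key (d :: d' :: ds) s).written ⊆
              (runList key (d' :: ds) (run key (longDir key s) s)).written := by
            rw [hd, hd']
            exact written_runList_mono (hs.valid_run key _) (hl.valid_run key _)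
              (written_prune h) ds
          exact ((Finset.card_le_card h2).trans h1).trans hp.1
        · have hd' : d' = !longDir key s := by
            cases d' <;> cases h : longDir key s <;> simp_all
          have := ih k (by omega) _ hss ds hk
          rw [hd, hd']
          exact this.trans hp.2

theorem card_search_mono (h : s.Valid M c) {i j : ℕ} (hij : i ≤ j) :
    (search key i s).written.card ≤ (search key j s).written.card := by
  induction hij with
  | refl => exact le_rfl
  | @step j _ ih =>
    obtain ⟨ds, h1, h2⟩ := exists_search_eq (key := key) j s
    refine ih.trans (le_trans ?_
      (card_runList_le_search (key := key) (j + 1) s h (ds ++ [true]) (by simp [h1])))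
    rw [runList_append, h2]
    exact Finset.card_le_card ((h.valid_runList key ds).written_subset_run key true)

/-- Search with `j`, …, `j + n` runs, until everything is written. -/
def deepen {β : Type*} (key : β → α) (s : State β) : ℕ → ℕ → State β
  | j, 0 => search key j s
  | j, n + 1 => if (search key j s).buf.isEmpty then search key j s else deepen key s (j + 1) n

theorem exists_deepen_eq {β : Type*} (key : β → α) (s : State β) (j n : ℕ) :
    ∃ i, j ≤ i ∧ i ≤ j + n ∧ deepen key s j n = search key i s ∧
      ((search key i s).buf = [] ∨ i = j + n) ∧
      ∀ i', j ≤ i' → i' < i → (search key i' s).buf ≠ [] := by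
  induction n generalizing j with
  | zero => exact ⟨j, le_rfl, le_rfl, rfl, Or.inr rfl, by omega⟩
  | succ n ih =>
    unfold deepen
    split_ifs with h
    · exact ⟨j, le_rfl, by omega, rfl, Or.inl (by simpa using h), by omega⟩
    · obtain ⟨i, h1, h2, h3, h4, h5⟩ := ih (j + 1)
      refine ⟨i, by omega, by omega, h3, h4.imp_right (by omega), fun i' hi hi' => ?_⟩
      rcases hi.eq_or_lt with rfl | hi
      · simpa using h
      · exact h5 i' hi hi'

theorem State.Valid.written_eq_univ (h : s.Valid M c) (hM : 1 ≤ M) :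
    s.buf = [] ↔ s.written = Finset.univ := by
  have hc := State.card_written h.nodup
  rw [← Finset.card_eq_iff_eq_univ, Fintype.card_fin, ← List.length_eq_zero_iff]
  have := congrArg List.length h.rest_eq
  simp only [List.length_drop, List.length_finRange] at this
  omega

theorem run_of_buf_eq_nil {β : Type*} {key : β → α} {s : State β} (h : s.buf = []) :
    run key b s = s := by
  obtain ⟨acc, K, J⟩ := s
  obtain rfl : K = [] := h
  simp [run, BTree.build, runLoop]

/-- `Ls` is a sequence of runs, of arbitrary directions, that can be written from the state in which
the items in `W` have been written. -/
def IsRunsFrom (M : ℕ) (key : Fin N → α) : Finset (Fin N) → List (List (Fin N)) → Prop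
  | _, [] => True
  | W, L :: Ls => (∃ b, IsRunFrom M key b W L) ∧ IsRunsFrom M key (W ∪ L.toFinset) Ls

variable {V : Finset (Fin N)} {Ls Ls' : List (List (Fin N))}

theorem isRunsFrom_append : IsRunsFrom M key V (Ls ++ Ls') ↔
    IsRunsFrom M key V Ls ∧ IsRunsFrom M key (V ∪ Ls.flatten.toFinset) Ls' := by
  induction Ls generalizing V with
  | nil => simp [IsRunsFrom]
  | cons L Ls ih => simp [IsRunsFrom, ih, and_assoc]

theorem IsRunsFrom.lt_of_mem (h : IsRunsFrom M key V Ls) (hV : ∀ z ∈ V, z.val < V.card + M) :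
    ∀ z ∈ V ∪ Ls.flatten.toFinset, z.val < (V ∪ Ls.flatten.toFinset).card + M := by
  induction Ls generalizing V with
  | nil => simpa using hV
  | cons L Ls ih =>
    obtain ⟨⟨b, hL⟩, hLs⟩ := h
    rw [List.flatten_cons, List.toFinset_append, ← Finset.union_assoc]
    refine ih hLs fun z hz => ?_
    rw [hL.card_union]
    rw [Finset.mem_union, List.mem_toFinset] at hz
    rcases hz with hz | hz
    · have := hV z hz; omega
    · obtain ⟨L₁, L₂, e⟩ := List.append_of_mem hz
      have h1 := hL.arr _ _ _ e
      have : L₁.length < L.length := by rw [e]; simp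
      omega

/-- Greedy runs keep up with any sequence of runs of the same directions. -/
theorem IsRunsFrom.exists_runList (h : IsRunsFrom M key V Ls) (hs : s.Valid M c)
    (hV : V ⊆ s.written) : ∃ ds, ds.length = Ls.length ∧
      V ∪ Ls.flatten.toFinset ⊆ (runList key ds s).written := by
  induction Ls generalizing V s with
  | nil => exact ⟨[], rfl, by simpa [runList] using hV⟩
  | cons L Ls ih =>
    obtain ⟨⟨b, hL⟩, hLs⟩ := h
    obtain ⟨_, _, hf, hw, hv, _⟩ := hs.run key b
    obtain ⟨ds, h1, h2⟩ := ih hLs hv (by rw [hw]; exact hf.mono_state hL hV)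
    refine ⟨b :: ds, by simp [h1], ?_⟩
    rw [List.flatten_cons, List.toFinset_append, ← Finset.union_assoc]
    exact h2

theorem IsRunsFrom.card_le_search (h : IsRunsFrom M key V Ls) (hs : s.Valid M c)
    (hV : V ⊆ s.written) :
    (V ∪ Ls.flatten.toFinset).card ≤ (search key Ls.length s).written.card := by
  obtain ⟨ds, h1, h2⟩ := h.exists_runList hs hV
  exact (Finset.card_le_card h2).trans (card_runList_le_search _ s hs ds h1)

/-- One block of the algorithm: a search for at most `k` runs, and one more run, by which the
algorithm gets ahead of every strategy that has written at most as many items. -/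
def block {β : Type*} (key : β → α) (k : ℕ) (s : State β) : State β :=
  run key true (deepen key s 1 (k - 1))

/-- If all items can be written with the runs `Ls`, then a block either writes everything with at
most that many runs, or is ahead of the first `k` of the runs `Ls`. -/
theorem block_spec (hM : 1 ≤ M) (hk : 1 ≤ k) (hs : s.Valid M c) (hne : s.buf ≠ [])
    (hVs : V ⊆ s.written) (hV : ∀ z ∈ V, z.val < V.card + M) (h : IsRunsFrom M key V Ls)
    (hu : V ∪ Ls.flatten.toFinset = Finset.univ) :
    ∃ ds, block key k s = runList key ds s ∧
      ((block key k s).buf = [] ∧ ds.length ≤ Ls.length ∨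
        ds.length = k + 1 ∧ k < Ls.length ∧
          V ∪ (Ls.take k).flatten.toFinset ⊆ (block key k s).written) := by
  obtain ⟨i, h1, h2, h3, h4, h5⟩ := exists_deepen_eq key s 1 (k - 1)
  obtain ⟨ds, hds, hi⟩ := exists_search_eq (key := key) i s
  have hfin : (search key Ls.length s).buf = [] := by
    rw [(hs.valid_search key _).written_eq_univ hM, ← Finset.card_eq_iff_eq_univ]
    refine le_antisymm (Finset.card_le_univ _) ?_
    have := h.card_le_search hs hVs
    rwa [hu, Finset.card_univ] at this
  have hpos : Ls.length ≠ 0 := by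
    intro h0
    rw [h0] at hfin
    exact hne hfin
  have hil : i ≤ Ls.length := by
    by_contra hlt
    exact h5 _ (by omega) (not_le.1 hlt) hfin
  by_cases hb : (search key i s).buf = []
  · refine ⟨ds, ?_, Or.inl ⟨?_, by omega⟩⟩
    · rw [block, h3, run_of_buf_eq_nil hb, hi]
    · rw [block, h3, run_of_buf_eq_nil hb, hb]
  · obtain rfl : i = k := by have := h4.resolve_left hb; omega
    have hlt : i < Ls.length := by
      refine lt_of_le_of_ne hil ?_
      rintro rfl
      exact hb hfin
    refine ⟨ds ++ [true], ?_, Or.inr ⟨by simp [hds], hlt, ?_⟩⟩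
    · rw [block, h3, hi, runList_append]
      rfl
    · rw [block, h3]
      have htake : IsRunsFrom M key V (Ls.take i) := by
        rw [← List.take_append_drop i Ls, isRunsFrom_append] at h
        exact h.1
      have hc := htake.card_le_search hs hVs
      rw [List.length_take_of_le hil] at hc
      obtain ⟨_, _, hf, hw, _⟩ := (hs.valid_search key i).run key true
      rw [hw]
      exact hf.subset_of_card_le (htake.lt_of_mem hV) hc

/-- The items written by a sequence of greedy runs. -/
theorem State.Valid.runList_spec (h : s.Valid M c) (key : Fin N → α) (ds : List Bool) :
    ∃ Os : List (List (Fin N)), Os.length = ds.length ∧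
      (runList key ds s).acc = Os.flatten.reverse ++ s.acc ∧
      (∀ O ∈ Os, IsRun (O.map key)) ∧
      ∀ S, Writes ((runList key ds s).buf.map key) ((runList key ds s).rest.map key) S →
        Writes (s.buf.map key) (s.rest.map key) (Os.flatten.map key ++ S) := by
  induction ds generalizing s with
  | nil => exact ⟨[], rfl, rfl, by simp, by simp [runList]⟩
  | cons d ds ih =>
    obtain ⟨out, ha, hf, _, hv, hwr⟩ := h.run key d
    obtain ⟨Os, h1, h2, h3, h4⟩ := ih hv
    refine ⟨out :: Os, by simp [h1], ?_, ?_, ?_⟩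
    · change (runList key ds (RunGen.run key d s)).acc = _
      rw [h2, ha]
      simp
    · intro O hO
      rcases List.mem_cons.1 hO with rfl | hO
      · exact isRun_of_pairwise_dirLE (b := d) (List.pairwise_map.2 hf.mono)
      · exact h3 O hO
    · intro S hS
      have := hwr _ (h4 S hS)
      simpa using this

/-- Every output of the buffer, as a sequence of values, comes from a sequence of items. -/
theorem State.Valid.exists_items_of_writes {α : Type*} {key : Fin N → α}
    (hs : s.Valid M c) {S : List α}
    (h : Writes (s.buf.map key) (s.rest.map key) S) :
    ∃ T : List (Fin N), T.map key = S ∧ T.Nodup ∧ (∀ x ∈ T, x ∉ s.written) ∧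
      (∀ L₁ x L₂, T = L₁ ++ x :: L₂ → x.val < s.written.card + L₁.length + M) ∧
      s.written ∪ T.toFinset = Finset.univ := by
  generalize hB : s.buf.map key = B at h
  generalize hJ : s.rest.map key = J at h
  induction h generalizing s c with
  | done =>
    refine ⟨[], rfl, by simp, by simp, by simp, ?_⟩
    simp only [List.map_eq_nil_iff] at hB hJ
    simp [State.written, hB, hJ]
  | write l r J S a _ ih =>
    obtain ⟨l', B', hb, rfl, hB'⟩ := List.map_eq_append_iff.1 hB
    obtain ⟨x, r', rfl, rfl, rfl⟩ := List.map_eq_cons_iff.1 hB'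
    subst hJ
    have hx : x ∈ s.buf := by simp [hb]
    set s' : State (Fin N) := ⟨x :: s.acc, l' ++ r' ++ s.rest.take 1, s.rest.drop 1⟩ with hs'
    have hperm : (s.buf ++ s.rest).Perm (x :: (s'.buf ++ s'.rest)) := by
      rw [hs', hb, List.append_assoc _ (s.rest.take 1), List.take_append_drop]
      simp
    have hnd := List.nodup_cons.1 (hperm.nodup_iff.1 hs.nodup)
    have hw : s'.written = insert x s.written := by
      ext z
      have h1 := hperm.mem_iff (a := z)
      have h2 : z = x → z ∉ s'.buf ++ s'.rest := fun h => h ▸ hnd.1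
      simp only [List.mem_append, List.mem_cons] at h1 h2
      simp only [State.mem_written, Finset.mem_insert]
      tauto
    have hxw : x ∉ s.written := fun h => (State.mem_written.1 h).1 hx
    have hcard : s'.written.card = s.written.card + 1 := by
      rw [hw, Finset.card_insert_of_notMem hxw]
    have hv : s'.Valid M c := by
      refine ⟨hnd.2, ?_, ?_, ?_⟩
      · change s.rest.drop 1 = _
        rw [hs.rest_eq, List.drop_drop, hcard]
        congr 1
        omega
      · intro z hz
        rw [hcard]
        rcases List.mem_append.1 hz with hz | hz
        · have := hs.buf_lt z (by rw [hb]; simp at hz ⊢; tauto)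
          omega
        · rw [hs.rest_eq] at hz
          have := mem_take_drop_finRange hz
          omega
      · rw [hcard, hs.card_eq, hs', List.length_cons]
        omega
    obtain ⟨T, h1, h2, h3, h4, h5⟩ := ih hv (by simp [hs']) (by simp [hs'])
    refine ⟨x :: T, by simp [h1], ?_, ?_, ?_, ?_⟩
    · exact List.nodup_cons.2 ⟨fun h => h3 x h (by simp [hw]), h2⟩
    · intro z hz
      rcases List.mem_cons.1 hz with rfl | hz
      · exact hxw
      · exact fun h => h3 z hz (by simp [hw, h])
    · intro L₁ z L₂ e
      cases L₁ with
      | nil =>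
        obtain ⟨rfl, rfl⟩ := List.cons.inj e
        simpa using hs.buf_lt _ hx
      | cons w L₁ =>
        obtain ⟨rfl, e'⟩ := List.cons.inj e
        have := h4 L₁ z L₂ e'
        rw [hcard] at this
        simp only [List.length_cons]
        omega
    · rw [← h5, hw]
      ext z
      simp

/-- A schedule of items whose values are a concatenation of runs is a sequence of runs. -/
theorem exists_isRunsFrom {T : List (Fin N)} (hnd : T.Nodup) (hd : ∀ x ∈ T, x ∉ V)
    (ha : ∀ L₁ x L₂, T = L₁ ++ x :: L₂ → x.val < V.card + L₁.length + M) {Rs : List (List α)}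
    (hR : Rs.flatten = T.map key) (hRs : ∀ r ∈ Rs, IsRun r) :
    ∃ Ls, Ls.length = Rs.length ∧ Ls.flatten = T ∧ IsRunsFrom M key V Ls := by
  induction Rs generalizing T V with
  | nil =>
    have : T = [] := by simpa using hR.symm
    exact ⟨[], rfl, by simp [this], trivial⟩
  | cons R Rs ih =>
    rw [List.flatten_cons] at hR
    obtain ⟨L, T', rfl, rfl, hT'⟩ := List.map_eq_append_iff.1 hR.symm
    obtain ⟨b, hb⟩ := (hRs _ List.mem_cons_self).exists_dirLE
    have hL : IsRunFrom M key b V L :=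
      { nodup := hnd.of_append_left
        disj := fun x hx => hd x (by simp [hx])
        arr := fun L₁ x L₂ e => ha L₁ x (L₂ ++ T') (by simp [e])
        mono := List.pairwise_map.1 hb }
    obtain ⟨Ls, h1, h2, h3⟩ := ih (T := T') (V := V ∪ L.toFinset) hnd.of_append_right
      (fun x hx hx' => by
        rw [Finset.mem_union, List.mem_toFinset] at hx'
        rcases hx' with h | h
        · exact hd x (by simp [hx]) h
        · exact List.disjoint_of_nodup_append hnd h hx)
      (fun L₁ x L₂ e => by
        have := ha (L ++ L₁) x L₂ (by simp [e])
        rw [hL.card_union]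
        rw [List.length_append] at this
        omega)
      hT'.symm (fun r hr => hRs r (List.mem_cons_of_mem _ hr))
    exact ⟨L :: Ls, by simp [h1], by simp [h2], ⟨b, hL⟩, h3⟩

end Search

/-! ### Evaluating expressions -/

section Semantics

namespace Val

variable {α : Type*}

def isNil : Val α → Bool
  | nil => true
  | _ => false

/-- The truth values of the machine. -/
def ofBool : Bool → Val α
  | true => cons nil nil
  | false => nil

/-- Comparison in the direction given by the first argument. -/
def dirLE [LinearOrder α] (b x y : Val α) : Val α :=
  if b.isNil then y.le x else x.le y

@[simp] theorem fst_cons (x y : Val α) : (cons x y).fst = x := rfl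
@[simp] theorem snd_cons (x y : Val α) : (cons x y).snd = y := rfl
@[simp] theorem isNil_nil : (nil : Val α).isNil = true := rfl
@[simp] theorem isNil_cons (x y : Val α) : (cons x y).isNil = false := rfl
@[simp] theorem isNil_ofBool (b : Bool) : (ofBool b : Val α).isNil = !b := by cases b <;> rfl

theorem eq_nil_of_isNil {v : Val α} (h : v.isNil = true) : v = nil := by
  cases v <;> simp_all [isNil]

theorem ne_nil_of_isNil {v : Val α} (h : v.isNil = false) : v ≠ nil := by
  rintro rfl
  simp at h

theorem dirLE_atom [LinearOrder α] (b : Bool) (x y : α) :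
    dirLE (ofBool b) (atom x) (atom y) = ofBool (decide (DirLE b x y)) := by
  cases b
  · by_cases h : y ≤ x <;> simp [dirLE, DirLE, le, h, ofBool]
  · by_cases h : x ≤ y <;> simp [dirLE, DirLE, le, h, ofBool]

theorem dirLE_nil [LinearOrder α] (b y : Val α) : dirLE b nil y = nil := by
  unfold dirLE
  split
  · cases y <;> rfl
  · rfl

end Val

variable {α : Type*} [LinearOrder α] (P : Program)

/-- Function number `f` of the program halts on argument `u`. -/
def Halts (f : ℕ) (u : Val α) : Prop :=
  ∃ v b t, P[f]? = some b ∧ Eval P [u] b v t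

open Classical in
/-- The value of function number `f` (`nil` if it does not halt). -/
noncomputable def fval (f : ℕ) (u : Val α) : Val α :=
  if h : Halts P f u then h.choose else .nil

open Classical in
/-- The running time of function number `f` (zero if it does not halt). -/
noncomputable def ftime (f : ℕ) (u : Val α) : ℕ :=
  if h : Halts P f u then h.choose_spec.choose_spec.choose else 0

theorem Halts.eval {P : Program} {f : ℕ} {u : Val α} (h : Halts P f u) :
    ∃ b, P[f]? = some b ∧ Eval P [u] b (fval P f u) (ftime P f u) := by
  refine ⟨h.choose_spec.choose, ?_⟩
  rw [fval, ftime, dif_pos h, dif_pos h]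
  exact h.choose_spec.choose_spec.choose_spec

/-- The value of an expression, as a total function. -/
noncomputable def den : List (Val α) → Expr → Val α
  | ρ, .var i => ρ[i]?.getD .nil
  | _, .nil => .nil
  | ρ, .cons e₁ e₂ => .cons (den ρ e₁) (den ρ e₂)
  | ρ, .fst e => (den ρ e).fst
  | ρ, .snd e => (den ρ e).snd
  | ρ, .le e₁ e₂ => (den ρ e₁).le (den ρ e₂)
  | ρ, .ite c e₁ e₂ => if (den ρ c).isNil then den ρ e₂ else den ρ e₁
  | ρ, .letE e b => den (den ρ e :: ρ) b
  | ρ, .call f e => fval P f (den ρ e)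

/-- The running time of an expression, as a total function. -/
noncomputable def tm : List (Val α) → Expr → ℕ
  | _, .var _ => 1
  | _, .nil => 1
  | ρ, .cons e₁ e₂ => tm ρ e₁ + tm ρ e₂ + 1
  | ρ, .fst e => tm ρ e + 1
  | ρ, .snd e => tm ρ e + 1
  | ρ, .le e₁ e₂ => tm ρ e₁ + tm ρ e₂ + 1
  | ρ, .ite c e₁ e₂ => tm ρ c + (if (den P ρ c).isNil then tm ρ e₂ else tm ρ e₁) + 1
  | ρ, .letE e b => tm ρ e + tm (den P ρ e :: ρ) b + 1
  | ρ, .call f e => tm ρ e + ftime P f (den P ρ e) + 1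

/-- All variables that occur in the evaluation are in scope, and all function calls halt. -/
def Safe : List (Val α) → Expr → Prop
  | ρ, .var i => i < ρ.length
  | _, .nil => True
  | ρ, .cons e₁ e₂ => Safe ρ e₁ ∧ Safe ρ e₂
  | ρ, .fst e => Safe ρ e
  | ρ, .snd e => Safe ρ e
  | ρ, .le e₁ e₂ => Safe ρ e₁ ∧ Safe ρ e₂
  | ρ, .ite c e₁ e₂ => Safe ρ c ∧ if (den P ρ c).isNil then Safe ρ e₂ else Safe ρ e₁
  | ρ, .letE e b => Safe ρ e ∧ Safe (den P ρ e :: ρ) b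
  | ρ, .call f e => Safe ρ e ∧ Halts P f (den P ρ e)

variable {P}

theorem Safe.eval {ρ : List (Val α)} {e : Expr} (h : Safe P ρ e) :
    Eval P ρ e (den P ρ e) (tm P ρ e) := by
  induction e generalizing ρ with
  | var i =>
    have h : i < ρ.length := h
    exact Eval.var (by simp [den, h])
  | nil => exact Eval.nil
  | cons e₁ e₂ ih₁ ih₂ => exact Eval.cons (ih₁ h.1) (ih₂ h.2)
  | fst e ih => exact Eval.fst (ih h)
  | snd e ih => exact Eval.snd (ih h)
  | le e₁ e₂ ih₁ ih₂ => exact Eval.le (ih₁ h.1) (ih₂ h.2)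
  | ite c e₁ e₂ ih ih₁ ih₂ =>
    obtain ⟨hc, h⟩ := h
    have hc := ih hc
    cases hn : (den P ρ c).isNil with
    | true =>
      rw [hn, if_pos rfl] at h
      rw [Val.eq_nil_of_isNil hn] at hc
      simp only [den, tm, hn, if_true]
      exact Eval.ite_false hc (ih₂ h)
    | false =>
      rw [hn, if_neg Bool.false_ne_true] at h
      simp only [den, tm, hn, Bool.false_eq_true, if_false]
      exact Eval.ite_true hc (Val.ne_nil_of_isNil hn) (ih₁ h)
  | letE e b ihe ihb => exact Eval.letE (ihe h.1) (ihb h.2)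
  | call f e ih =>
    obtain ⟨he, hf⟩ := h
    obtain ⟨b, hb, hev⟩ := hf.eval
    exact Eval.call (ih he) hb hev

variable (P) in
/-- Function number `f` maps `u` to `v` in at most `T` steps. -/
def Res (f : ℕ) (u v : Val α) (T : ℕ) : Prop :=
  Halts P f u ∧ fval P f u = v ∧ ftime P f u ≤ T

theorem Res.mono {f : ℕ} {u v : Val α} {T T' : ℕ} (h : Res P f u v T) (hT : T ≤ T') :
    Res P f u v T' :=
  ⟨h.1, h.2.1, h.2.2.trans hT⟩

theorem Res.of_body {f : ℕ} {u v : Val α} {T : ℕ} {e : Expr} (hf : P[f]? = some e)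
    (hs : Safe P [u] e) (hv : den P [u] e = v) (ht : tm P [u] e ≤ T) : Res P f u v T := by
  have hh : Halts P f u := ⟨_, e, _, hf, hs.eval⟩
  obtain ⟨e', he', hev⟩ := hh.eval
  obtain rfl : e = e' := Option.some.inj (hf.symm.trans he')
  obtain ⟨h1, h2⟩ := hev.unique hs.eval
  exact ⟨hh, h1.trans hv, h2.le.trans ht⟩

end Semantics

/-! ### The program -/

section Prog

def Expr.tt : Expr := .cons .nil .nil

/-- Comparison of `x` and `y` in direction `b`. -/
def Expr.dirLE (b x y : Expr) : Expr := .ite b (.le x y) (.le y x)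

def fEntry : ℕ := 0
def fInsert : ℕ := 1
def fBuild : ℕ := 2
def fPop : ℕ := 3
def fReplace : ℕ := 4
def fLoop : ℕ := 5
def fRun : ℕ := 6
def fLenLE : ℕ := 7
def fSearch : ℕ := 8
def fDeepen : ℕ := 9
def fAppend : ℕ := 10
def fReverse : ℕ := 11
def fMain : ℕ := 12
def fSplit : ℕ := 13

/-- Argument `(b, (y, t))`; see `BTree.insert`. -/
def insertBody : Expr :=
  let b := Expr.fst (.var 0)
  let y := Expr.fst (.snd (.var 0))
  let t := Expr.snd (.snd (.var 0))
  let x := Expr.fst t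
  let l := Expr.fst (.snd t)
  let r := Expr.snd (.snd t)
  .ite t
    (.ite (.dirLE b x y)
      (.cons x (.cons (.call fInsert (.cons b (.cons y r))) l))
      (.cons y (.cons (.call fInsert (.cons b (.cons x r))) l)))
    (.cons y (.cons .nil .nil))

/-- Argument `(b, K)`; see `BTree.build`. -/
def buildBody : Expr :=
  let b := Expr.fst (.var 0)
  let K := Expr.snd (.var 0)
  .ite K (.call fInsert (.cons b (.cons (.fst K) (.call fBuild (.cons b (.snd K)))))) .nil

/-- Argument `(b, t)`; see `BTree.pop`. -/
def popBody : Expr :=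
  let b := Expr.fst (.var 0)
  let t := Expr.snd (.var 0)
  let l := Expr.fst (.snd t)
  let r := Expr.snd (.snd t)
  .ite t
    (.ite l
      (.ite r
        (.ite (.dirLE b (.fst l) (.fst r))
          (.cons (.fst l) (.cons (.call fPop (.cons b l)) r))
          (.cons (.fst r) (.cons l (.call fPop (.cons b r)))))
        l)
      r)
    .nil

/-- Argument `(b, (y, t))`; see `BTree.replace`. -/
def replaceBody : Expr :=
  let b := Expr.fst (.var 0)
  let y := Expr.fst (.snd (.var 0))
  let t := Expr.snd (.snd (.var 0))
  let l := Expr.fst (.snd t)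
  let r := Expr.snd (.snd t)
  let left := Expr.cons (.fst l) (.cons (.call fReplace (.cons b (.cons y l))) r)
  let right := Expr.cons (.fst r) (.cons l (.call fReplace (.cons b (.cons y r))))
  .ite t
    (.ite (.dirLE b (.fst l) y)
      (.ite (.dirLE b (.fst r) (.fst l)) right left)
      (.ite (.dirLE b (.fst r) y) right (.cons y (.cons l r))))
    .nil

/-- Argument `(b, (t, (J, (K, acc))))`; see `runLoop`. -/
def loopBody : Expr :=
  let b := Expr.fst (.var 0)
  let t := Expr.fst (.snd (.var 0))
  let J := Expr.fst (.snd (.snd (.var 0)))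
  let K := Expr.fst (.snd (.snd (.snd (.var 0))))
  let acc := Expr.snd (.snd (.snd (.snd (.var 0))))
  let acc' := Expr.cons (.fst t) acc
  .ite t
    (.ite J
      (.ite (.dirLE b (.fst t) (.fst J))
        (.call fLoop (.cons b (.cons (.call fReplace (.cons b (.cons (.fst J) t)))
          (.cons (.snd J) (.cons K acc')))))
        (.call fLoop (.cons b (.cons (.call fPop (.cons b t))
          (.cons (.snd J) (.cons (.cons (.fst J) K) acc'))))))
      (.call fLoop (.cons b (.cons (.call fPop (.cons b t)) (.cons .nil (.cons K acc'))))))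
    (.cons acc (.cons K J))

/-- Argument `(b, s)`, where a state `s` is a triple `(acc, (buf, rest))`; see `run`. -/
def runBody : Expr :=
  let b := Expr.fst (.var 0)
  let s := Expr.snd (.var 0)
  .call fLoop (.cons b (.cons (.call fBuild (.cons b (.fst (.snd s))))
    (.cons (.snd (.snd s)) (.cons .nil (.fst s)))))

/-- Argument `(p, q)`: is the list `p` at most as long as the list `q`? -/
def lenLEBody : Expr :=
  let p := Expr.fst (.var 0)
  let q := Expr.snd (.var 0)
  .ite p (.ite q (.call fLenLE (.cons (.snd p) (.snd q))) .nil) .tt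

/-- The body of `searchBody` after the two runs, of which variable `l` holds the longer one and
variable `s` the shorter one, in direction `b`. -/
def searchBranch (l s : ℕ) (b : Expr) : Expr :=
  let k := Expr.snd (.fst (.var 2))
  .ite k
    (.letE (.call fSearch (.cons (.snd k) (.call fRun (.cons b (.var s)))))
      (.letE (.call fSearch (.cons (.snd (.fst (.var 3))) (.var (l + 1))))
        (.ite (.call fLenLE (.cons (.fst (.var 1)) (.fst (.var 0)))) (.var 0) (.var 1))))
    (.var l)

/-- Argument `(k, s)`; see `search`. -/
def searchBody : Expr :=
  .ite (.fst (.var 0))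
    (.letE (.call fRun (.cons .tt (.snd (.var 0))))
      (.letE (.call fRun (.cons .nil (.snd (.var 1))))
        (.ite (.call fLenLE (.cons (.fst (.var 1)) (.fst (.var 0))))
          (searchBranch 0 1 .tt) (searchBranch 1 0 .nil))))
    (.snd (.var 0))

/-- Argument `(j, (n, s))`; see `deepen`. -/
def deepenBody : Expr :=
  let j := Expr.fst (.var 1)
  let n := Expr.fst (.snd (.var 1))
  let s := Expr.snd (.snd (.var 1))
  .letE (.call fSearch (.cons (.fst (.var 0)) (.snd (.snd (.var 0)))))
    (.ite (.fst (.snd (.var 0)))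
      (.ite n (.call fDeepen (.cons (.cons .nil j) (.cons (.snd n) s))) (.var 0))
      (.var 0))

/-- Argument `(p, q)`: concatenation. -/
def appendBody : Expr :=
  let p := Expr.fst (.var 0)
  let q := Expr.snd (.var 0)
  .ite p (.cons (.fst p) (.call fAppend (.cons (.snd p) q))) q

/-- Argument `(p, q)`: the reverse of `p`, followed by `q`. -/
def reverseBody : Expr :=
  let p := Expr.fst (.var 0)
  let q := Expr.snd (.var 0)
  .ite p (.call fReverse (.cons (.snd p) (.cons (.fst p) q))) q

/-- Argument `(k, (buf, (rest, out)))`: blocks until everything is written. -/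
def mainBody : Expr :=
  let K := Expr.fst (.snd (.var 0))
  .ite K
    (.letE (.call fRun (.cons .tt (.call fDeepen (.cons (.cons .nil .nil)
        (.cons (.snd (.fst (.var 0))) (.cons .nil (.cons K (.fst (.snd (.snd (.var 0)))))))))))
      (.call fMain (.cons (.fst (.var 1)) (.cons (.fst (.snd (.var 0)))
        (.cons (.snd (.snd (.var 0)))
          (.call fAppend (.cons (.fst (.var 0)) (.snd (.snd (.snd (.var 1)))))))))))
    (.call fReverse (.cons (.snd (.snd (.snd (.var 0)))) .nil))

/-- Argument `(M, I)`: the first `M` elements of `I`, and the other ones. -/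
def splitBody : Expr :=
  let M := Expr.fst (.var 0)
  let I := Expr.snd (.var 0)
  .ite M
    (.ite I
      (.letE (.call fSplit (.cons (.snd M) (.snd I)))
        (.cons (.cons (.fst (.snd (.var 1))) (.fst (.var 0))) (.snd (.var 0))))
      (.cons .nil .nil))
    (.cons .nil I)

/-- Argument `(k, (M, I))`. -/
def entryBody : Expr :=
  .letE (.call fSplit (.snd (.var 0)))
    (.call fMain (.cons (.fst (.var 1)) (.cons (.fst (.var 0)) (.cons (.snd (.var 0)) .nil))))

/-- The approximation scheme. -/
def prog : Program :=
  [entryBody, insertBody, buildBody, popBody, replaceBody, loopBody, runBody, lenLEBody, searchBody,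
    deepenBody, appendBody, reverseBody, mainBody, splitBody]

end Prog

/-! ### Correctness and running time of the heap operations and of the runs -/

section Encoding

variable {α : Type*} {β : Type*} (key : β → α)

/-- The representation of a list of items by their values. -/
def encList (l : List β) : Val α := .ofList (l.map key)

/-- The representation of a heap: a node is a triple `(x, (l, r))`. -/
def encTree : BTree β → Val α
  | .leaf => .nil
  | .node x l r => .cons (.atom (key x)) (.cons (encTree l) (encTree r))

def encState (s : State β) : Val α :=
  .cons (encList key s.acc) (.cons (encList key s.buf) (encList key s.rest))

variable {key}

@[simp] theorem encList_nil : encList key [] = .nil := rfl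
@[simp] theorem encList_cons (x : β) (l : List β) :
    encList key (x :: l) = .cons (.atom (key x)) (encList key l) := rfl
@[simp] theorem encTree_leaf : encTree key .leaf = .nil := rfl
@[simp] theorem encTree_node (x : β) (l r : BTree β) :
    encTree key (.node x l r) = .cons (.atom (key x)) (.cons (encTree key l) (encTree key r)) := rfl

end Encoding

section Basic

variable {α : Type*} [LinearOrder α] {β : Type*} {key : β → α}

theorem dirLE_fst_encTree (b : Bool) (t : BTree β) (y : β) :
    Val.dirLE (.ofBool b) (encTree key t).fst (.atom (key y)) =
      .ofBool (decide (t.Beats key b y)) := by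
  cases t with
  | leaf =>
    rw [decide_eq_false (by exact id), encTree_leaf, Val.fst, Val.dirLE_nil, Val.ofBool]
    rintro _ _ ⟨⟩
  | node x l r => simp [Val.dirLE_atom, BTree.Beats]

theorem BTree.Beats.fst_encTree {b : Bool} {t : BTree β} {y : β} (h : t.Beats key b y) (d : β) :
    (encTree key t).fst = .atom (key (t.root d)) := by
  cases t with
  | leaf => exact h.elim
  | node x l r => rfl

section

variable {P : Program} {ρ : List (Val α)} {b x y : Expr}

@[simp] theorem den_dirLE : den P ρ (.dirLE b x y) =
    Val.dirLE (den P ρ b) (den P ρ x) (den P ρ y) := rfl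

@[simp] theorem tm_dirLE : tm P ρ (.dirLE b x y) = tm P ρ b + tm P ρ x + tm P ρ y + 2 := by
  simp only [Expr.dirLE, tm]
  split <;> omega

@[simp] theorem safe_dirLE : Safe P ρ (.dirLE b x y) ↔
    Safe P ρ b ∧ Safe P ρ x ∧ Safe P ρ y := by
  simp only [Expr.dirLE, Safe]
  split <;> tauto

end

variable (b : Bool)

theorem res_insert (y : β) (t : BTree β) :
    Res prog fInsert (.cons (.ofBool b) (.cons (.atom (key y)) (encTree key t)))
      (encTree key (t.insert key b y)) (60 * (t.depth + 1)) := by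
  induction t generalizing y with
  | leaf =>
    refine Res.of_body (e := insertBody) rfl ?_ ?_ ?_ <;>
      simp [insertBody, den, tm, Safe, BTree.insert, BTree.depth]
  | node x l r _ ih =>
    obtain ⟨h1, h2, h3⟩ := ih x
    obtain ⟨g1, g2, g3⟩ := ih y
    have hr : r.depth ≤ max l.depth r.depth := le_max_right _ _
    by_cases hxy : DirLE b (key x) (key y)
    · refine Res.of_body (e := insertBody) rfl ?_ ?_ ?_
      · simp [insertBody, den, Safe, Val.dirLE_atom, hxy, g1]
      · simp [insertBody, den, Val.dirLE_atom, hxy, g2, BTree.insert]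
      · simp [insertBody, den, tm, Val.dirLE_atom, hxy, BTree.depth]
        omega
    · refine Res.of_body (e := insertBody) rfl ?_ ?_ ?_
      · simp [insertBody, den, Safe, Val.dirLE_atom, hxy, h1]
      · simp [insertBody, den, Val.dirLE_atom, hxy, h2, BTree.insert]
      · simp [insertBody, den, tm, Val.dirLE_atom, hxy, BTree.depth]
        omega

theorem res_build (K : List β) {D : ℕ} (hD : Nat.log 2 K.length ≤ D) :
    Res prog fBuild (.cons (.ofBool b) (encList key K)) (encTree key (BTree.build key b K))
      ((K.length + 1) * (60 * (D + 3))) := by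
  induction K with
  | nil =>
    refine Res.of_body (e := buildBody) rfl ?_ ?_ ?_
    · simp [buildBody, den, Safe]
    · simp [buildBody, den, BTree.build]
    · simp [buildBody, den, tm]
      omega
  | cons y K ih =>
    have hD' : Nat.log 2 K.length ≤ D := (Nat.log_mono_right (by simp)).trans hD
    obtain ⟨h1, h2, h3⟩ := ih hD'
    obtain ⟨g1, g2, g3⟩ := res_insert (key := key) b y (BTree.build key b K)
    have hd := BTree.depth_build_le (key := key) (b := b) K
    refine Res.of_body (e := buildBody) rfl ?_ ?_ ?_
    · simp [buildBody, den, Safe, h1, h2, g1]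
    · change _ = encTree key (BTree.insert key b y (BTree.build key b K))
      simp [buildBody, den, h2, g2]
    · simp [buildBody, den, tm, h2]
      nlinarith

theorem res_pop (t : BTree β) :
    Res prog fPop (.cons (.ofBool b) (encTree key t)) (encTree key (t.pop key b))
      (80 * (t.depth + 1)) := by
  induction t with
  | leaf =>
    refine Res.of_body (e := popBody) rfl ?_ ?_ ?_ <;>
      simp [popBody, den, tm, Safe, BTree.pop, BTree.depth]
  | node w l r ihl ihr =>
    cases l with
    | leaf =>
      refine Res.of_body (e := popBody) rfl ?_ ?_ ?_
      · simp [popBody, den, Safe]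
      · simp [popBody, den, BTree.pop]
      · simp [popBody, den, tm]
        omega
    | node x l₁ l₂ =>
      cases r with
      | leaf =>
        refine Res.of_body (e := popBody) rfl ?_ ?_ ?_
        · simp [popBody, den, Safe]
        · simp [popBody, den, BTree.pop]
        · simp [popBody, den, tm]
          omega
      | node y r₁ r₂ =>
        obtain ⟨h1, h2, h3⟩ := ihl
        obtain ⟨g1, g2, g3⟩ := ihr
        rw [encTree_node] at h1 h2 h3 g1 g2 g3
        by_cases hxy : DirLE b (key x) (key y)
        · refine Res.of_body (e := popBody) rfl ?_ ?_ ?_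
          · simp [popBody, den, Safe, Val.dirLE_atom, hxy, h1]
          · have e : BTree.pop key b (.node w (.node x l₁ l₂) (.node y r₁ r₂)) =
                .node x (BTree.pop key b (.node x l₁ l₂)) (.node y r₁ r₂) := by
              rw [BTree.pop, if_pos hxy]
            rw [e]
            simp [popBody, den, Val.dirLE_atom, hxy, h2]
          · simp [popBody, den, tm, Val.dirLE_atom, hxy]
            rw [BTree.depth]
            omega
        · refine Res.of_body (e := popBody) rfl ?_ ?_ ?_
          · simp [popBody, den, Safe, Val.dirLE_atom, hxy, g1]
          · have e : BTree.pop key b (.node w (.node x l₁ l₂) (.node y r₁ r₂)) =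
                .node y (.node x l₁ l₂) (BTree.pop key b (.node y r₁ r₂)) := by
              rw [BTree.pop, if_neg hxy]
            rw [e]
            simp [popBody, den, Val.dirLE_atom, hxy, g2]
          · simp [popBody, den, tm, Val.dirLE_atom, hxy]
            rw [BTree.depth]
            omega

theorem res_replace (y : β) (t : BTree β) :
    Res prog fReplace (.cons (.ofBool b) (.cons (.atom (key y)) (encTree key t)))
      (encTree key (t.replace key b y)) (120 * (t.depth + 1)) := by
  induction t with
  | leaf =>
    refine Res.of_body (e := replaceBody) rfl ?_ ?_ ?_ <;>
      simp [replaceBody, den, tm, Safe, BTree.replace, BTree.depth]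
  | node w l r ihl ihr =>
    obtain ⟨h1, h2, h3⟩ := ihl
    obtain ⟨g1, g2, g3⟩ := ihr
    have hl : l.depth ≤ max l.depth r.depth := le_max_left _ _
    have hr : r.depth ≤ max l.depth r.depth := le_max_right _ _
    by_cases hly : l.Beats key b y
    · have el := hly.fst_encTree y
      have cl := hly.root_le y
      by_cases hrl : r.Beats key b (l.root y)
      · have er := hrl.fst_encTree y
        have cr := hrl.root_le y
        refine Res.of_body (e := replaceBody) rfl ?_ ?_ ?_
        · simp [replaceBody, den, Safe, dirLE_fst_encTree, Val.dirLE_atom, el, cl, hrl, g1]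
        · simp [replaceBody, den, Val.dirLE_atom, el, er, cl, cr, hly, hrl, g2, BTree.replace]
        · simp [replaceBody, den, tm, dirLE_fst_encTree, Val.dirLE_atom, el, cl, hrl, BTree.depth]
          omega
      · refine Res.of_body (e := replaceBody) rfl ?_ ?_ ?_
        · simp [replaceBody, den, Safe, dirLE_fst_encTree, Val.dirLE_atom, el, cl, hrl, h1]
        · simp [replaceBody, den, dirLE_fst_encTree, Val.dirLE_atom, el, cl, hly, hrl, h2,
            BTree.replace]
        · simp [replaceBody, den, tm, dirLE_fst_encTree, Val.dirLE_atom, el, cl, hrl, BTree.depth]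
          omega
    · by_cases hry : r.Beats key b y
      · have er := hry.fst_encTree y
        have cr := hry.root_le y
        refine Res.of_body (e := replaceBody) rfl ?_ ?_ ?_
        · simp [replaceBody, den, Safe, dirLE_fst_encTree, hly, hry, g1]
        · simp [replaceBody, den, dirLE_fst_encTree, Val.dirLE_atom, er, cr, hly, hry, g2,
            BTree.replace]
        · simp [replaceBody, den, tm, dirLE_fst_encTree, hly, hry, BTree.depth]
          omega
      · refine Res.of_body (e := replaceBody) rfl ?_ ?_ ?_
        · simp [replaceBody, den, Safe, dirLE_fst_encTree, hly, hry]
        · simp [replaceBody, den, dirLE_fst_encTree, hly, hry, BTree.replace]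
        · simp [replaceBody, den, tm, dirLE_fst_encTree, hly, hry, BTree.depth]
          omega

end Basic

section Basic

variable {α : Type*} [LinearOrder α] {β : Type*} {key : β → α} (b : Bool)

theorem res_loop (t : BTree β) (J K acc : List β) {D : ℕ} (hD : t.depth ≤ D) :
    ∃ T, Res prog fLoop (.cons (.ofBool b) (.cons (encTree key t)
        (.cons (encList key J) (.cons (encList key K) (encList key acc)))))
      (encState key (runLoop key b t J K acc)) T ∧
      T + acc.length * (300 * (D + 1)) ≤
        ((runLoop key b t J K acc).acc.length + 1) * (300 * (D + 1)) := by
  fun_induction runLoop key b t J K acc with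
  | case1 K acc J =>
    refine ⟨_, Res.of_body (e := loopBody) rfl ?_ ?_ le_rfl, ?_⟩
    · simp [loopBody, den, Safe]
    · simp [loopBody, den, encState]
    · simp [loopBody, den, tm]
      nlinarith
  | case2 K acc x l r ih =>
    obtain ⟨T, ⟨h1, h2, h3⟩, h4⟩ := ih ((BTree.depth_pop_le _).trans hD)
    obtain ⟨g1, g2, g3⟩ := res_pop (key := key) b (.node x l r)
    rw [encTree_node] at g1 g2 g3
    rw [encList_cons, encList_nil] at h1 h2 h3
    refine ⟨_, Res.of_body (e := loopBody) rfl ?_ ?_ le_rfl, ?_⟩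
    · simp [loopBody, den, Safe, g1, g2, h1]
    · simp [loopBody, den, g2, h2]
    · simp [loopBody, den, tm, g2]
      rw [List.length_cons] at h4
      nlinarith
  | case3 K acc x l r y J hxy ih =>
    obtain ⟨T, ⟨h1, h2, h3⟩, h4⟩ := ih ((BTree.depth_replace_le _ _).trans hD)
    obtain ⟨g1, g2, g3⟩ := res_replace (key := key) b y (.node x l r)
    rw [encTree_node] at g1 g2 g3
    rw [encList_cons] at h1 h2 h3
    refine ⟨_, Res.of_body (e := loopBody) rfl ?_ ?_ le_rfl, ?_⟩
    · simp [loopBody, den, Safe, Val.dirLE_atom, hxy, g1, g2, h1]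
    · simp [loopBody, den, Val.dirLE_atom, hxy, g2, h2]
    · simp [loopBody, den, tm, Val.dirLE_atom, hxy, g2]
      rw [List.length_cons] at h4
      nlinarith
  | case4 K acc x l r y J hxy ih =>
    obtain ⟨T, ⟨h1, h2, h3⟩, h4⟩ := ih ((BTree.depth_pop_le _).trans hD)
    obtain ⟨g1, g2, g3⟩ := res_pop (key := key) b (.node x l r)
    rw [encTree_node] at g1 g2 g3
    rw [encList_cons, encList_cons] at h1 h2 h3
    refine ⟨_, Res.of_body (e := loopBody) rfl ?_ ?_ le_rfl, ?_⟩
    · simp [loopBody, den, Safe, Val.dirLE_atom, hxy, g1, g2, h1]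
    · simp [loopBody, den, Val.dirLE_atom, hxy, g2, h2]
    · simp [loopBody, den, tm, Val.dirLE_atom, hxy, g2]
      rw [List.length_cons] at h4
      nlinarith

theorem length_acc_runLoop (t : BTree β) (J K acc : List β) :
    t.toList.length + acc.length ≤ (runLoop key b t J K acc).acc.length := by
  fun_induction runLoop key b t J K acc with
  | case1 K acc J => simp [BTree.toList]
  | case2 K acc x l r ih =>
    rw [(BTree.pop_perm x l r).length_eq] at ih
    simp only [BTree.toList, List.length_cons] at ih ⊢
    omega
  | case3 K acc x l r y J hxy ih =>
    rw [(BTree.replace_perm x y l r).length_eq] at ih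
    simp only [BTree.toList, List.length_cons] at ih ⊢
    omega
  | case4 K acc x l r y J hxy ih =>
    rw [(BTree.pop_perm x l r).length_eq] at ih
    simp only [BTree.toList, List.length_cons] at ih ⊢
    omega

/-- Everything that is in the buffer at the start of a greedy run is written. -/
theorem length_buf_add_le (s : State β) :
    s.buf.length + s.acc.length ≤ (run key b s).acc.length := by
  have := length_acc_runLoop (key := key) b (BTree.build key b s.buf) s.rest [] s.acc
  rwa [(BTree.build_perm s.buf).length_eq] at this

theorem res_run (s : State β) {D : ℕ} (hD : Nat.log 2 s.buf.length ≤ D) :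
    Res prog fRun (.cons (.ofBool b) (encState key s)) (encState key (run key b s))
      (((run key b s).acc.length + 1) * (400 * (D + 3))) := by
  obtain ⟨g1, g2, g3⟩ := res_build (key := key) b s.buf hD
  have hd := (BTree.depth_build_le (key := key) (b := b) s.buf).trans (Nat.succ_le_succ hD)
  obtain ⟨T, ⟨h1, h2, h3⟩, h4⟩ := res_loop (key := key) b _ s.rest [] s.acc hd
  have hl := length_buf_add_le (key := key) b s
  rw [encList_nil] at h1 h2 h3
  refine Res.of_body (e := runBody) rfl ?_ ?_ ?_
  · simp [runBody, den, Safe, encState, g1, g2, h1]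
  · simp only [runBody, den, encState] at *
    simp [g2, h2, run]
  · simp [runBody, den, tm, encState, g2]
    change _ ≤ ((run key b s).acc.length + 1) * _ at h4
    generalize (run key b s).acc.length = n at *
    generalize s.buf.length = m at *
    generalize s.acc.length = a at *
    have h5 : (m + 1) * (60 * (D + 3)) ≤ (n + 1) * (60 * (D + 3)) :=
      Nat.mul_le_mul_right _ (by omega)
    have h6 : 40 * 1 ≤ (n + 1) * (40 * (D + 3)) := by nlinarith
    nlinarith

theorem res_lenLE (p q : List β) :
    Res prog fLenLE (.cons (encList key p) (encList key q))
      (.ofBool (decide (p.length ≤ q.length))) (40 * (p.length + 1)) := by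
  induction p generalizing q with
  | nil =>
    refine Res.of_body (e := lenLEBody) rfl ?_ ?_ ?_ <;>
      simp [lenLEBody, Expr.tt, den, tm, Safe, Val.ofBool]
  | cons x p ih =>
    cases q with
    | nil =>
      refine Res.of_body (e := lenLEBody) rfl ?_ ?_ ?_
      · simp [lenLEBody, den, Safe]
      · simp [lenLEBody, den, Val.ofBool]
      · simp [lenLEBody, den, tm]; omega
    | cons y q =>
      obtain ⟨h1, h2, h3⟩ := ih q
      refine Res.of_body (e := lenLEBody) rfl ?_ ?_ ?_
      · simp [lenLEBody, den, Safe, h1]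
      · simp [lenLEBody, den, h2]
      · simp [lenLEBody, den, tm]; omega

theorem res_append (p q : List β) :
    Res prog fAppend (.cons (encList key p) (encList key q)) (encList key (p ++ q))
      (40 * (p.length + 1)) := by
  induction p with
  | nil =>
    refine Res.of_body (e := appendBody) rfl ?_ ?_ ?_ <;>
      simp [appendBody, den, tm, Safe]
  | cons x p ih =>
    obtain ⟨h1, h2, h3⟩ := ih
    refine Res.of_body (e := appendBody) rfl ?_ ?_ ?_
    · simp [appendBody, den, Safe, h1]
    · simp [appendBody, den, h2]
    · simp [appendBody, den, tm]; omega

theorem res_reverse (p q : List β) :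
    Res prog fReverse (.cons (encList key p) (encList key q)) (encList key (p.reverse ++ q))
      (40 * (p.length + 1)) := by
  induction p generalizing q with
  | nil =>
    refine Res.of_body (e := reverseBody) rfl ?_ ?_ ?_ <;>
      simp [reverseBody, den, tm, Safe]
  | cons x p ih =>
    obtain ⟨h1, h2, h3⟩ := ih (x :: q)
    rw [encList_cons] at h1 h2 h3
    refine Res.of_body (e := reverseBody) rfl ?_ ?_ ?_
    · simp [reverseBody, den, Safe, h1]
    · simp [reverseBody, den, h2]
    · simp [reverseBody, den, tm]; omega

theorem res_split (M : ℕ) (I : List β) :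
    Res prog fSplit (.cons (.ofNat M) (encList key I))
      (.cons (encList key (I.take M)) (encList key (I.drop M))) (40 * (I.length + 1)) := by
  induction M generalizing I with
  | zero =>
    refine Res.of_body (e := splitBody) rfl ?_ ?_ ?_
    · simp [splitBody, den, Safe, Val.ofNat]
    · simp [splitBody, den, Val.ofNat]
    · simp [splitBody, den, tm, Val.ofNat]; omega
  | succ M ih =>
    cases I with
    | nil =>
      refine Res.of_body (e := splitBody) rfl ?_ ?_ ?_ <;>
        simp [splitBody, den, tm, Safe, Val.ofNat]
    | cons x I =>
      obtain ⟨h1, h2, h3⟩ := ih I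
      refine Res.of_body (e := splitBody) rfl ?_ ?_ ?_
      · simp [splitBody, den, Safe, Val.ofNat, h1]
      · simp [splitBody, den, Val.ofNat, h2]
      · simp [splitBody, den, tm, Val.ofNat]; omega

end Basic

/-! ### Correctness and running time of the search -/

section Scheme

section

variable {α : Type*}

@[simp] theorem fst_encState {β : Type*} (key : β → α) (s : State β) :
    (encState key s).fst = encList key s.acc := rfl

@[simp] theorem snd_encState {β : Type*} (key : β → α) (s : State β) :
    (encState key s).snd = .cons (encList key s.buf) (encList key s.rest) := rfl

@[simp] theorem ofNat_succ (n : ℕ) : (Val.ofNat (n + 1) : Val α) = .cons .nil (.ofNat n) := rfl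

@[simp] theorem ofNat_zero : (Val.ofNat 0 : Val α) = .nil := rfl

end

variable {α : Type*} [LinearOrder α]

theorem length_acc_le_run {β : Type*} {key : β → α} (b : Bool) (s : State β) :
    s.acc.length ≤ (run key b s).acc.length := by
  have := length_buf_add_le (key := key) b s
  omega

theorem length_acc_le_search {β : Type*} {key : β → α} (k : ℕ) (s : State β) :
    s.acc.length ≤ (search key k s).acc.length := by
  fun_induction search key k s with
  | case1 s => exact le_rfl
  | case2 s => exact length_acc_le_run _ _
  | case3 k s _ _ ih => exact (length_acc_le_run _ _).trans ih
  | case4 k s _ ih _ => exact ((length_acc_le_run _ _).trans (length_acc_le_run _ _)).trans ih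

variable {N M c : ℕ} {key : Fin N → α} {s : State (Fin N)}

theorem State.Valid.log_le (h : s.Valid M c) : Nat.log 2 s.buf.length ≤ Nat.log 2 N := by
  have := State.card_written h.nodup
  exact Nat.log_mono_right (by omega)

/-- The time of a greedy run, per element written. -/
def runCost (N : ℕ) : ℕ := 400 * (Nat.log 2 N + 3)

theorem le_runCost (N : ℕ) : 1200 ≤ runCost N := by
  unfold runCost; omega

theorem State.Valid.res_run (h : s.Valid M c) (key : Fin N → α) (b : Bool) :
    Res prog fRun (.cons (.ofBool b) (encState key s)) (encState key (RunGen.run key b s))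
      (((RunGen.run key b s).acc.length + 1) * runCost N) :=
  RunGen.res_run b s h.log_le

/-- The time of `search k`, as a multiple of `runCost`, per element written. -/
def searchCost : ℕ → ℕ
  | 0 => 1
  | 1 => 4
  | k + 2 => searchCost (k + 1) + searchCost k + 6

theorem searchCost_le (k : ℕ) : searchCost k + 6 ≤ 10 * Nat.fib (k + 2) := by
  induction k using Nat.twoStepInduction with
  | zero => simp [searchCost]
  | one => simp [searchCost, Nat.fib]
  | more k ih1 ih2 =>
    have e : Nat.fib (k + 2 + 2) = Nat.fib (k + 2) + Nat.fib (k + 1 + 2) := Nat.fib_add_two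
    rw [searchCost, e]
    omega

theorem res_search (k : ℕ) (s : State (Fin N)) (h : s.Valid M c) :
    Res prog fSearch (.cons (.ofNat k) (encState key s)) (encState key (search key k s))
      (searchCost k * (((search key k s).acc.length + 1) * runCost N)) := by
  have hY := le_runCost N
  induction k using Nat.strong_induction_on generalizing s with
  | _ k ih =>
    obtain ⟨u1, u2, u3⟩ := h.res_run key true
    obtain ⟨d1, d2, d3⟩ := h.res_run key false
    obtain ⟨l1, l2, l3⟩ := res_lenLE (key := key) (run key true s).acc (run key false s).acc
    have hu := length_run_le_longDir (key := key) s true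
    have hd := length_run_le_longDir (key := key) s false
    match k, ih with
    | 0, _ =>
      refine Res.of_body (e := searchBody) rfl ?_ ?_ ?_
      · simp [searchBody, den, Safe]
      · simp [searchBody, den, search]
      · simp [searchBody, den, tm, searchCost]
        nlinarith
    | 1, _ =>
      have hZu := Nat.mul_le_mul_right (runCost N) (Nat.succ_le_succ hu)
      have hZd := Nat.mul_le_mul_right (runCost N) (Nat.succ_le_succ hd)
      by_cases hlen : (run key true s).acc.length ≤ (run key false s).acc.length
      · have hl : longDir key s = false := by simpa [longDir] using hlen
        simp only [Val.ofBool] at u1 u2 u3 d1 d2 d3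
        refine Res.of_body (e := searchBody) rfl ?_ ?_ ?_
        · simp [searchBody, searchBranch, Expr.tt, den, Safe, u1, u2, d1, d2, l1, l2, hlen]
        · simp [searchBody, searchBranch, Expr.tt, den, search, u2, d2, l2, hlen, hl]
        · simp [searchBody, searchBranch, Expr.tt, den, tm, search, u2, d2, l2, hlen, hl,
            searchCost]
          rw [hl] at hZu hZd
          nlinarith
      · have hl : longDir key s = true := by simpa [longDir] using hlen
        simp only [Val.ofBool] at u1 u2 u3 d1 d2 d3
        refine Res.of_body (e := searchBody) rfl ?_ ?_ ?_
        · simp [searchBody, searchBranch, Expr.tt, den, Safe, u1, u2, d1, d2, l1, l2, hlen]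
        · simp [searchBody, searchBranch, Expr.tt, den, search, u2, d2, l2, hlen, hl]
        · simp [searchBody, searchBranch, Expr.tt, den, tm, search, u2, d2, l2, hlen, hl,
            searchCost]
          rw [hl] at hZu hZd
          nlinarith
    | k + 2, ih =>
      have hlv := h.valid_run key (longDir key s)
      have hsv := h.valid_run key (!longDir key s)
      have hssv := hsv.valid_run key (!longDir key s)
      obtain ⟨r1, r2, r3⟩ := hsv.res_run key (!longDir key s)
      have hres : (search key (k + 1) (run key (longDir key s) s)).acc.length ≤
            (search key (k + 2) s).acc.length ∧
          (search key k (run key (!longDir key s) (run key (!longDir key s) s))).acc.length ≤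
            (search key (k + 2) s).acc.length := by
        rw [search]
        split_ifs with hc
        · exact ⟨le_rfl, hc⟩
        · exact ⟨(not_le.1 hc).le, le_rfl⟩
      have hsearch : search key (k + 2) s =
          if (search key k (run key (!longDir key s) (run key (!longDir key s) s))).acc.length ≤
              (search key (k + 1) (run key (longDir key s) s)).acc.length then
            search key (k + 1) (run key (longDir key s) s)
          else search key k (run key (!longDir key s) (run key (!longDir key s) s)) := by
        rw [search]
      obtain ⟨p1, p2, p3⟩ := ih (k + 1) (by omega) _ hlv
      obtain ⟨q1, q2, q3⟩ := ih k (by omega) _ hssv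
      have hp := length_acc_le_search (key := key) (k + 1) (run key (longDir key s) s)
      have hq := length_acc_le_search (key := key) k
        (run key (!longDir key s) (run key (!longDir key s) s))
      generalize hpd : search key (k + 1) (run key (longDir key s) s) = p at *
      generalize hqd : search key k (run key (!longDir key s) (run key (!longDir key s) s)) = q at *
      generalize hsd : search key (k + 2) s = r at *
      obtain ⟨m1, m2, m3⟩ := res_lenLE (key := key) q.acc p.acc
      -- All states that are computed have written at most as much as the final one.
      have hb : ∀ n, n ≤ r.acc.length → (n + 1) * runCost N ≤ (r.acc.length + 1) * runCost N :=
        fun n hn => Nat.mul_le_mul_right _ (Nat.succ_le_succ hn)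
      have hb' : ∀ n, n ≤ r.acc.length →
          40 * (n + 1) + 200 ≤ (r.acc.length + 1) * runCost N :=
        fun n hn => le_trans (by nlinarith) (hb n hn)
      replace u3 := u3.trans (hb _ (hu.trans (hp.trans hres.1)))
      replace d3 := d3.trans (hb _ (hd.trans (hp.trans hres.1)))
      replace r3 := r3.trans (hb _ (hq.trans hres.2))
      replace p3 := p3.trans (Nat.mul_le_mul_left _ (hb _ hres.1))
      replace q3 := q3.trans (Nat.mul_le_mul_left _ (hb _ hres.2))
      replace l3 := (Nat.le_sub_of_add_le (hb' _ (hu.trans (hp.trans hres.1)))).trans' l3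
      replace m3 := (Nat.le_sub_of_add_le (hb' _ hres.2)).trans' m3
      have hZ := hb' 0 (Nat.zero_le _)
      generalize (r.acc.length + 1) * runCost N = Z at *
      have hZs : searchCost (k + 2) * Z = searchCost (k + 1) * Z + searchCost k * Z + 6 * Z := by
        rw [searchCost]; ring
      have hr : encState key r =
          if (decide (q.acc.length ≤ p.acc.length)) then encState key p else encState key q := by
        rw [hsearch]
        by_cases hc : q.acc.length ≤ p.acc.length <;> simp [hc]
      generalize decide (q.acc.length ≤ p.acc.length) = e at *
      by_cases hlen : (run key true s).acc.length ≤ (run key false s).acc.length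
      · have hl : longDir key s = false := by simpa [longDir] using hlen
        simp only [hl, Bool.not_false, ofNat_succ] at r1 r2 r3 p1 p2 p3 q1 q2 q3
        simp only [Val.ofBool] at u1 u2 u3 d1 d2 d3 r1 r2 r3
        refine Res.of_body (e := searchBody) rfl ?_ ?_ ?_
        · simp [searchBody, searchBranch, Expr.tt, den, Safe, u1, u2, d1, d2, l1, l2, hlen, r1, r2,
            q1, q2, p1, p2, m1]
        · rw [hr]
          cases e <;>
            simp [searchBody, searchBranch, Expr.tt, den, u2, d2, l2, hlen, r2, q2, p2, m2]
        · simp [searchBody, searchBranch, Expr.tt, den, tm, u2, d2, l2, hlen, r2, q2, p2]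
          omega
      · have hl : longDir key s = true := by simpa [longDir] using hlen
        simp only [hl, Bool.not_true, ofNat_succ] at r1 r2 r3 p1 p2 p3 q1 q2 q3
        simp only [Val.ofBool] at u1 u2 u3 d1 d2 d3 r1 r2 r3
        refine Res.of_body (e := searchBody) rfl ?_ ?_ ?_
        · simp [searchBody, searchBranch, Expr.tt, den, Safe, u1, u2, d1, d2, l1, l2, hlen, r1, r2,
            q1, q2, p1, p2, m1]
        · rw [hr]
          cases e <;>
            simp [searchBody, searchBranch, Expr.tt, den, u2, d2, l2, hlen, r2, q2, p2, m2]
        · simp [searchBody, searchBranch, Expr.tt, den, tm, u2, d2, l2, hlen, r2, q2, p2]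
          omega

end Scheme

/-! ### Correctness and running time of the main loop -/

section Main

variable {α : Type*} [LinearOrder α] {N M c k : ℕ} {key : Fin N → α} {s : State (Fin N)}

theorem length_acc_search_le_deepen (h : s.Valid M c) (j n : ℕ) :
    (search key j s).acc.length ≤ (deepen key s j n).acc.length := by
  obtain ⟨i, h1, -, h3, -⟩ := exists_deepen_eq key s j n
  have h4 := card_search_mono (key := key) h h1
  rw [(h.valid_search key j).card_eq, (h.valid_search key i).card_eq] at h4
  rw [h3]
  omega

/-- The search for `i` runs costs `O(fib (i + 2))` per item, for `i = j, …, j + n`.  The term with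
`fib (j + 3)` on the left makes the sum telescope, as `fib (j + 4) = fib (j + 2) + fib (j + 3)`. -/
theorem res_deepen (h : s.Valid M c) (j n : ℕ) :
    ∃ T, Res prog fDeepen (.cons (.ofNat j) (.cons (.ofNat n) (encState key s)))
        (encState key (deepen key s j n)) T ∧
      T + 10 * Nat.fib (j + 3) * (((deepen key s j n).acc.length + 1) * runCost N) ≤
        10 * Nat.fib (j + n + 4) * (((deepen key s j n).acc.length + 1) * runCost N) := by
  have hY := le_runCost N
  induction n generalizing j with
  | zero =>
    obtain ⟨h1, h2, h3⟩ := res_search (key := key) j s h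
    have hc := searchCost_le j
    have e : Nat.fib (j + 4) = Nat.fib (j + 2) + Nat.fib (j + 3) := Nat.fib_add_two
    have hd : deepen key s j 0 = search key j s := rfl
    rw [hd, Nat.add_zero, e]
    refine ⟨_, Res.of_body (e := deepenBody) rfl ?_ ?_ le_rfl, ?_⟩
    · simp [deepenBody, den, Safe, h1, h2]
    · simp [deepenBody, den, h2]
    · simp [deepenBody, den, tm, h2]
      have hZ : runCost N ≤ ((search key j s).acc.length + 1) * runCost N :=
        Nat.le_mul_of_pos_left _ (Nat.succ_pos _)
      generalize ((search key j s).acc.length + 1) * runCost N = Z at *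
      have := Nat.mul_le_mul_right Z hc
      split_ifs <;> nlinarith
  | succ n ih =>
    obtain ⟨h1, h2, h3⟩ := res_search (key := key) j s h
    have hc := searchCost_le j
    have e : Nat.fib (j + 4) = Nat.fib (j + 2) + Nat.fib (j + 3) := Nat.fib_add_two
    have hmono := length_acc_search_le_deepen (key := key) h j (n + 1)
    have hZ := Nat.mul_le_mul_right (runCost N) (Nat.succ_le_succ hmono)
    have hZ' : runCost N ≤ ((deepen key s j (n + 1)).acc.length + 1) * runCost N :=
      Nat.le_mul_of_pos_left _ (Nat.succ_pos _)
    replace h3 := h3.trans (Nat.mul_le_mul_left _ hZ)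
    cases hb : (search key j s).buf with
    | nil =>
      have hd : deepen key s j (n + 1) = search key j s := by simp [deepen, hb]
      have e' : Nat.fib (j + 4) ≤ Nat.fib (j + (n + 1) + 4) := Nat.fib_mono (by omega)
      refine ⟨_, Res.of_body (e := deepenBody) rfl ?_ ?_ le_rfl, ?_⟩
      · simp [deepenBody, den, Safe, h1, h2, hb]
      · simp [deepenBody, den, h2, hb, hd]
      · simp [deepenBody, den, tm, h2, hb]
        generalize ((deepen key s j (n + 1)).acc.length + 1) * runCost N = Z at *
        have := Nat.mul_le_mul_right Z hc
        have := Nat.mul_le_mul_right Z e'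
        rw [e] at this
        nlinarith
    | cons x l =>
      obtain ⟨T, ⟨g1, g2, g3⟩, g4⟩ := ih (j + 1)
      have hd : deepen key s j (n + 1) = deepen key s (j + 1) n := by simp [deepen, hb]
      have e1 : j + 1 + n + 4 = j + (n + 1) + 4 := by omega
      rw [ofNat_succ] at g1 g2 g3
      rw [← hd, e1, show j + 1 + 3 = j + 4 from rfl, e] at g4
      refine ⟨_, Res.of_body (e := deepenBody) rfl ?_ ?_ le_rfl, ?_⟩
      · simp [deepenBody, den, Safe, h1, h2, hb, g1]
      · simp [deepenBody, den, h2, hb, g2, hd]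
      · simp [deepenBody, den, tm, h2, hb]
        generalize ((deepen key s j (n + 1)).acc.length + 1) * runCost N = Z at *
        have := Nat.mul_le_mul_right Z hc
        nlinarith

theorem State.Valid.reset (h : s.Valid M c) :
    State.Valid M (c + s.acc.length) ⟨[], s.buf, s.rest⟩ :=
  ⟨h.nodup, h.rest_eq, h.buf_lt, h.card_eq⟩

/-- A block makes progress as long as the buffer is not empty. -/
theorem length_acc_block_pos (hM : 1 ≤ M) (hs : s.Valid M c) (hne : s.buf ≠ []) :
    0 < (block key k s).acc.length := by
  by_contra h0
  have h1 := length_buf_add_le (key := key) true (deepen key s 1 (k - 1))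
  obtain ⟨i, -, -, h3, -⟩ := exists_deepen_eq key s 1 (k - 1)
  have hv := hs.valid_search key i
  have hl := length_acc_le_search (key := key) i s
  rw [block] at h0
  rw [h3] at h0 h1
  have hb : (search key i s).buf = [] := List.length_eq_zero_iff.1 (by omega)
  refine hne ((hs.written_eq_univ hM).2 ?_)
  have h4 := (hv.written_eq_univ hM).1 hb
  rw [← Finset.card_eq_iff_eq_univ, hv.card_eq] at h4
  rw [← Finset.card_eq_iff_eq_univ, hs.card_eq]
  omega

/-- The cost of a block in terms of the number of items that it writes. -/
theorem res_block (hs : s.Valid M c) (hpos : 0 < (block key (k + 1) s).acc.length) :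
    ∃ T, Res prog fDeepen (.cons (.cons .nil .nil) (.cons (.ofNat k) (encState key s)))
        (encState key (deepen key s 1 k)) T ∧
      Res prog fRun (.cons (.cons .nil .nil) (encState key (deepen key s 1 k)))
        (encState key (block key (k + 1) s))
        (2 * (block key (k + 1) s).acc.length * runCost N) ∧
      T ≤ 20 * Nat.fib (k + 5) * ((block key (k + 1) s).acc.length * runCost N) := by
  obtain ⟨T, h1, h2⟩ := res_deepen (key := key) hs 1 k
  obtain ⟨i, -, -, h3, -⟩ := exists_deepen_eq key s 1 k
  have hv : (deepen key s 1 k).Valid M c := h3 ▸ hs.valid_search key i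
  have h4 := hv.res_run key true
  have h5 := length_acc_le_run (key := key) true (deepen key s 1 k)
  change (deepen key s 1 k).acc.length ≤ (block key (k + 1) s).acc.length at h5
  refine ⟨T, h1, h4.mono (Nat.mul_le_mul_right _ ?_), ?_⟩
  · change (block key (k + 1) s).acc.length + 1 ≤ _
    omega
  · have h6 : ((deepen key s 1 k).acc.length + 1) * runCost N ≤
        2 * (block key (k + 1) s).acc.length * runCost N := Nat.mul_le_mul_right _ (by omega)
    have h7 := Nat.mul_le_mul_left (10 * Nat.fib (1 + k + 4)) h6
    rw [show k + 5 = 1 + k + 4 by omega]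
    refine (Nat.le_of_add_right_le h2).trans (h7.trans_eq ?_)
    ring

/-- The main loop, when all items can be written by the runs `Ls` from a state which is not ahead
of the present one. -/
theorem res_main (hM : 1 ≤ M) {V : Finset (Fin N)} {Ls : List (List (Fin N))} (hs : s.Valid M c)
    (hacc : s.acc = []) (hVs : V ⊆ s.written) (hV : ∀ z ∈ V, z.val < V.card + M)
    (h : IsRunsFrom M key V Ls) (hu : V ∪ Ls.flatten.toFinset = Finset.univ)
    (out : List (Fin N)) :
    ∃ (Os : List (List (Fin N))) (T : ℕ),
      Res prog fMain (.cons (.ofNat (k + 1)) (.cons (encList key s.buf)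
        (.cons (encList key s.rest) (encList key out))))
        (encList key (out.reverse ++ Os.flatten)) T ∧
      Writes (s.buf.map key) (s.rest.map key) (Os.flatten.map key) ∧
      (∀ O ∈ Os, IsRun (O.map key)) ∧
      Os.length ≤ Ls.length + (Ls.length - 1) / (k + 1) ∧
      T ≤ 30 * Nat.fib (k + 5) * ((s.buf.length + s.rest.length) * runCost N) +
        40 * (out.length + (s.buf.length + s.rest.length) + 2) := by
  have hY := le_runCost N
  induction hn : s.buf.length + s.rest.length using Nat.strong_induction_on
    generalizing s c V Ls out with
  | _ n ih =>
    cases hb : s.buf with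
    | nil =>
      have hw := (hs.written_eq_univ hM).1 hb
      have hr : s.rest = [] := by
        refine List.eq_nil_iff_forall_not_mem.2 fun z => ?_
        have : z ∈ s.written := by simp [hw]
        exact (State.mem_written.1 this).2
      obtain ⟨h1, h2, h3⟩ := res_reverse (key := key) out []
      rw [encList_nil] at h1 h2 h3
      refine ⟨[], _, Res.of_body (e := mainBody) rfl ?_ ?_ le_rfl, ?_, by simp, by simp, ?_⟩
      · simp [mainBody, den, Safe, h1]
      · simp [mainBody, den, h2]
      · simpa [hr] using Writes.done
      · simp [mainBody, den, tm]
        omega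
    | cons x B =>
      have hne : s.buf ≠ [] := by simp [hb]
      have hpos := length_acc_block_pos (key := key) (k := k + 1) hM hs hne
      obtain ⟨T, ⟨d1, d2, d3⟩, ⟨r1, r2, r3⟩, hT⟩ := res_block hs hpos
      obtain ⟨ds, hds, hcase⟩ :=
        block_spec (key := key) (k := k + 1) hM (by omega) hs hne hVs hV h hu
      obtain ⟨Os, hO1, hO2, hO3, hO4⟩ := hs.runList_spec key ds
      have hv := hs.valid_runList key ds
      rw [← hds] at hO2 hO4 hv
      rw [hacc, List.append_nil] at hO2
      generalize block key (k + 1) s = s1 at *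
      obtain ⟨a1, a2, a3⟩ := res_append (key := key) s1.acc out
      have hcards := State.card_written hs.nodup
      have hcards1 := State.card_written hv.nodup
      have hce := hs.card_eq
      have hce1 := hv.card_eq
      rw [hacc, List.length_nil] at hce
      have hlt : s1.buf.length + s1.rest.length + s1.acc.length = n := by omega
      obtain ⟨V', Ls', hV's, hV', h', hu', hcount⟩ : ∃ V' Ls', V' ⊆ s1.written ∧
          (∀ z ∈ V', z.val < V'.card + M) ∧ IsRunsFrom M key V' Ls' ∧
          V' ∪ Ls'.flatten.toFinset = Finset.univ ∧
          Os.length + (Ls'.length + (Ls'.length - 1) / (k + 1)) ≤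
            Ls.length + (Ls.length - 1) / (k + 1) := by
        -- Either nothing is left to do, or the block has used one run more than the `k + 1` runs of
        -- `Ls` that it has overtaken.
        rcases hcase with ⟨hfin, hlen⟩ | ⟨hlen, hk, hsub⟩
        · refine ⟨s1.written, [], subset_rfl, hv.lt_of_mem, trivial, ?_, ?_⟩
          · simp [(hv.written_eq_univ hM).1 hfin]
          · simp only [List.length_nil, Nat.zero_sub, Nat.zero_div]
            exact le_trans (by omega) (Nat.le_add_right _ _)
        · rw [← List.take_append_drop (k + 1) Ls] at h hu
          obtain ⟨ht, hd⟩ := isRunsFrom_append.1 h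
          refine ⟨_, Ls.drop (k + 1), hsub, ht.lt_of_mem hV, hd, ?_, ?_⟩
          · rw [← hu, List.flatten_append, List.toFinset_append, Finset.union_assoc]
          · have e : Ls.length - 1 = (Ls.length - (k + 1) - 1) + (k + 1) := by omega
            rw [e, Nat.add_div_right _ (show 0 < k + 1 by omega), List.length_drop, hO1, hlen]
            omega
      obtain ⟨Os', T', ⟨m1, m2, m3⟩, hw', hR', hc', hT'⟩ :=
        ih (s1.buf.length + s1.rest.length) (by omega) hv.reset rfl hV's hV' h' hu'
          (s1.acc ++ out) rfl
      simp only [ofNat_succ] at m1 m2 m3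
      have hes : encState key s = .cons .nil (.cons (.cons (.atom (key x)) (encList key B))
          (encList key s.rest)) := by
        simp [encState, hacc, hb]
      rw [hes] at d1 d2 d3
      refine ⟨Os ++ Os', _, Res.of_body (e := mainBody) rfl ?_ ?_ le_rfl, ?_, ?_, ?_, ?_⟩
      · simp [mainBody, Expr.tt, den, Safe, d1, d2, r1, r2, a1, a2, m1]
      · simp [mainBody, Expr.tt, den, d2, r2, a2, m2]
        simp [hO2]
      · have := hO4 _ hw'
        simpa [hb] using this
      · intro O hO
        rcases List.mem_append.1 hO with hO | hO
        · exact hO3 O hO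
        · exact hR' O hO
      · rw [List.length_append]
        omega
      · simp [mainBody, Expr.tt, den, tm, d2, r2, a2]
        have hf : 1 ≤ Nat.fib (k + 5) := Nat.fib_pos.2 (by omega)
        have e : n = s1.buf.length + s1.rest.length + s1.acc.length := hlt.symm
        rw [e]
        simp only [List.length_append] at hT'
        generalize s1.buf.length + s1.rest.length = n' at *
        generalize s1.acc.length = a at *
        generalize Nat.fib (k + 5) = f at *
        have h1 : a * 1200 ≤ a * runCost N := Nat.mul_le_mul_left _ hY
        have h2 : a * runCost N ≤ f * (a * runCost N) := Nat.le_mul_of_pos_left _ hf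
        have h3 : 30 * f * ((n' + a) * runCost N) =
            30 * f * (n' * runCost N) + 30 * (f * (a * runCost N)) := by ring
        have h4 : 20 * f * (a * runCost N) = 20 * (f * (a * runCost N)) := by ring
        have h5 : 2 * a * runCost N = 2 * (a * runCost N) := by ring
        rw [h3]
        rw [h4] at hT
        rw [h5] at r3
        generalize f * (a * runCost N) = X at *
        generalize a * runCost N = Y at *
        generalize 30 * f * (n' * runCost N) = W at *
        omega

end Main

/-! ### The approximation scheme -/

section Final

variable {α : Type*} [LinearOrder α]

theorem map_get_finRange {α : Type*} (I : List α) : (List.finRange I.length).map I.get = I := by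
  apply List.ext_getElem <;> simp

theorem runs_flatten_le {Rs : List (List α)} (h : ∀ r ∈ Rs, IsRun r) :
    runs Rs.flatten ≤ Rs.length :=
  Nat.sInf_le ⟨Rs, rfl, rfl, h⟩

theorem exists_length_eq_runs (S : List α) :
    ∃ Rs : List (List α), Rs.length = runs S ∧ Rs.flatten = S ∧ ∀ r ∈ Rs, IsRun r := by
  refine Nat.sInf_mem (s := {n | ∃ L : List (List α), L.length = n ∧ L.flatten = S ∧
    ∀ r ∈ L, IsRun r}) ⟨_, S.map fun a => [a], rfl, ?_, ?_⟩
  · induction S with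
    | nil => rfl
    | cons a S ih => simp [ih]
  · intro r hr
    obtain ⟨a, -, rfl⟩ := List.mem_map.1 hr
    exact Or.inl (List.pairwise_singleton _ _)

theorem exists_runs_eq_opt {M : ℕ} (hM : 1 ≤ M) (I : List α) :
    ∃ S, IsOutput M I S ∧ runs S = opt M I :=
  Nat.sInf_mem (s := {n | ∃ S : List α, IsOutput M I S ∧ runs S = n})
    ⟨_, I, isOutput_self hM I, rfl⟩

/-- The state at the beginning: nothing is written, and the buffer holds the first `M` items. -/
def initState (N M : ℕ) : State (Fin N) :=
  ⟨[], (List.finRange N).take M, (List.finRange N).drop M⟩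

theorem written_initState (N M : ℕ) : (initState N M).written = ∅ := by
  ext z
  have : z ∈ (List.finRange N).take M ++ (List.finRange N).drop M := by simp
  simp only [State.mem_written, initState]
  rw [List.mem_append] at this
  simp only [Finset.notMem_empty, iff_false]
  tauto

theorem valid_initState (N M : ℕ) : (initState N M).Valid M 0 where
  nodup := by simpa [initState] using List.nodup_finRange N
  rest_eq := by rw [written_initState]; simp [initState]
  buf_lt z hz := by
    rw [written_initState]
    exact mem_take_drop_finRange (k := 0) hz
  card_eq := by rw [written_initState]; simp [initState]

/-- The guarantee of the program for a block length `k + 1`: every `k + 1` runs of an optimal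
strategy except the last ones cost one additional run. -/
theorem exists_outputsIn {M : ℕ} (hM : 1 ≤ M) (k : ℕ) (I : List α) :
    ∃ (S : List α) (t : ℕ), prog.OutputsIn (k + 1) M I S t ∧ IsOutput M I S ∧
      runs S ≤ opt M I + (opt M I - 1) / (k + 1) ∧
      t ≤ 30 * Nat.fib (k + 5) * (I.length * runCost I.length) + 80 * (I.length + 3) := by
  obtain ⟨S₀, hS₀, hopt⟩ := exists_runs_eq_opt hM I
  obtain ⟨Rs, hRl, hRf, hRr⟩ := exists_length_eq_runs S₀
  set s := initState I.length M with hs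
  have hv : s.Valid M 0 := valid_initState _ _
  have hw : s.written = ∅ := written_initState _ _
  have hbuf : s.buf.map I.get = I.take M := by
    rw [hs, initState, List.map_take, map_get_finRange]
  have hrest : s.rest.map I.get = I.drop M := by
    rw [hs, initState, List.map_drop, map_get_finRange]
  unfold IsOutput at hS₀
  rw [← hbuf, ← hrest] at hS₀
  obtain ⟨T₀, hT1, hT2, hT3, hT4, hT5⟩ := hv.exists_items_of_writes hS₀
  obtain ⟨Ls, hL1, hL2, hL3⟩ := exists_isRunsFrom hT2 hT3 hT4 (hRf.trans hT1.symm) hRr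
  obtain ⟨Os, T, ⟨m1, m2, m3⟩, hwr, hruns, hlen, htime⟩ :=
    res_main (k := k) hM hv rfl subset_rfl hv.lt_of_mem hL3 (hL2 ▸ hT5) []
  have hN : s.buf.length + s.rest.length = I.length := by
    simpa [hw] using State.card_written hv.nodup
  rw [hN] at htime
  have hI : encList I.get (List.finRange I.length) = .ofList I := by
    rw [encList, map_get_finRange]
  obtain ⟨p1, p2, p3⟩ := res_split (key := I.get) M (List.finRange I.length)
  rw [hI] at p1 p2 p3
  rw [List.length_finRange] at p3
  change fval prog fSplit _ = .cons (encList I.get s.buf) (encList I.get s.rest) at p2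
  simp only [encList_nil, ofNat_succ, List.reverse_nil, List.nil_append] at m1 m2 m3
  have hres : Res prog fEntry (.cons (.ofNat (k + 1)) (.cons (.ofNat M) (.ofList I)))
      (.ofList (Os.flatten.map I.get))
      (30 * Nat.fib (k + 5) * (I.length * runCost I.length) + 80 * (I.length + 3) - 2) := by
    refine Res.of_body (e := entryBody) rfl ?_ ?_ ?_
    · simp [entryBody, den, Safe, p1, p2, m1]
    · simp only [entryBody, den, Val.fst_cons, Val.snd_cons, List.getElem?_cons_zero,
        List.getElem?_cons_succ, Option.getD_some, p2, ofNat_succ, m2]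
      rfl
    · simp [entryBody, den, tm, p2]
      simp only [List.length_nil] at htime
      omega
  refine ⟨Os.flatten.map I.get,
    ftime prog fEntry (.cons (.ofNat (k + 1)) (.cons (.ofNat M) (.ofList I))) + 2, ?_, ?_, ?_, ?_⟩
  · obtain ⟨b, hb, hev⟩ := hres.1.eval
    rw [hres.2.1] at hev
    have := Eval.call (P := prog)
      (ρ := [.cons (.ofNat (k + 1)) (.cons (.ofNat M) (.ofList I))]) (Eval.var (i := 0) rfl) hb hev
    unfold Program.OutputsIn
    rw [show ∀ n, n + 2 = 1 + n + 1 by omega]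
    exact this
  · unfold IsOutput
    rw [← hbuf, ← hrest]
    exact hwr
  · rw [List.map_flatten]
    refine (runs_flatten_le fun r hr => ?_).trans ?_
    · obtain ⟨O, hO, rfl⟩ := List.mem_map.1 hr
      exact hruns O hO
    · rw [List.length_map, ← hopt, ← hRl, ← hL1]
      exact hlen
  · have := hres.2.2
    omega

theorem fib_succ_le_goldenRatio_pow (n : ℕ) :
    (Nat.fib (n + 1) : ℝ) ≤ Real.goldenRatio ^ (n + 1) := by
  rw [← Real.goldenRatio_mul_fib_succ_add_fib]
  have h1 := Real.one_lt_goldenRatio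
  have h2 : (0 : ℝ) ≤ Nat.fib n := Nat.cast_nonneg _
  have h3 : (0 : ℝ) ≤ Nat.fib (n + 1) := Nat.cast_nonneg _
  nlinarith

theorem runCost_le {N : ℕ} (hN : 2 ≤ N) : (runCost N : ℝ) ≤ 1600 / Real.log 2 * Real.log N := by
  have h2 : 0 < Real.log 2 := Real.log_pos (by norm_num)
  have h1 := Real.natLog_le_logb N 2
  have h3 : Real.log 2 ≤ Real.log N :=
    Real.log_le_log (by norm_num) (by exact_mod_cast hN)
  have h4 : 1 ≤ Real.logb 2 N := by
    rw [Real.logb, le_div_iff₀ h2]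
    linarith
  have e : 1600 / Real.log 2 * Real.log N = 1600 * Real.logb 2 N := by
    rw [Real.logb]; ring
  rw [e]
  unfold runCost
  push_cast
  norm_num at h1
  linarith

/-- The program `prog` has the approximation ratio and the running time that are claimed. -/
theorem exists_approximation_scheme {ε : ℝ} (hε : 0 < ε) {M : ℕ} (hM : 1 ≤ M) (I : List α) :
    ∃ (S : List α) (t : ℕ), prog.OutputsIn ⌈1 / ε⌉₊ M I S t ∧ IsOutput M I S ∧
      (runs S : ℝ) ≤ (1 + ε) * (opt M I : ℝ) ∧
      (2 ≤ I.length → (t : ℝ) ≤ 31 * Real.goldenRatio ^ 5 * (1600 / Real.log 2) *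
        (Real.goldenRatio ^ (1 / ε) * I.length * Real.log I.length)) := by
  have hpos : 0 < 1 / ε := by positivity
  obtain ⟨k, hk⟩ : ∃ k, ⌈1 / ε⌉₊ = k + 1 :=
    ⟨⌈1 / ε⌉₊ - 1, by have := Nat.ceil_pos.2 hpos; omega⟩
  have hk1 : 1 / ε ≤ (k : ℝ) + 1 := by
    have := Nat.le_ceil (1 / ε)
    rw [hk] at this
    exact_mod_cast this
  have hk2 : (k : ℝ) ≤ 1 / ε := by
    have := Nat.ceil_lt_add_one hpos.le
    rw [hk] at this
    push_cast at this
    linarith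
  obtain ⟨S, t, h1, h2, h3, h4⟩ := exists_outputsIn hM k I
  rw [hk]
  refine ⟨S, t, h1, h2, ?_, fun hN => ?_⟩
  · have h5 : (runs S : ℝ) ≤ (opt M I : ℝ) + (opt M I : ℝ) / ((k : ℝ) + 1) := by
      have h6 : (((opt M I - 1) / (k + 1) : ℕ) : ℝ) ≤ (opt M I : ℝ) / ((k : ℝ) + 1) := by
        refine Nat.cast_div_le.trans ?_
        push_cast
        gcongr
        exact Nat.sub_le _ _
      have h7 : (runs S : ℝ) ≤ ((opt M I + (opt M I - 1) / (k + 1) : ℕ) : ℝ) := by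
        exact_mod_cast h3
      push_cast at h7 h6
      linarith
    have h8 : (opt M I : ℝ) / ((k : ℝ) + 1) ≤ ε * opt M I := by
      rw [div_le_iff₀ (by positivity)]
      have h9 : 1 ≤ ε * ((k : ℝ) + 1) := by
        rw [div_le_iff₀ hε] at hk1
        linarith
      have h10 : (0 : ℝ) ≤ opt M I := Nat.cast_nonneg _
      nlinarith
    linarith
  · have hφ := Real.one_lt_goldenRatio
    have ht : t ≤ 31 * Nat.fib (k + 5) * (I.length * runCost I.length) := by
      have h5 := le_runCost I.length
      have h6 : 1 ≤ Nat.fib (k + 5) := Nat.fib_pos.2 (by omega)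
      have h7 : I.length * 1200 ≤ I.length * runCost I.length := Nat.mul_le_mul_left _ h5
      have h8 : I.length * runCost I.length ≤
          Nat.fib (k + 5) * (I.length * runCost I.length) := Nat.le_mul_of_pos_left _ h6
      rw [mul_assoc] at h4 ⊢
      omega
    have hfib : (Nat.fib (k + 5) : ℝ) ≤ Real.goldenRatio ^ 5 * Real.goldenRatio ^ (1 / ε) := by
      have h5 := fib_succ_le_goldenRatio_pow (k + 4)
      rw [show k + 4 + 1 = k + 5 by rfl] at h5
      refine h5.trans ?_
      rw [add_comm, pow_add]
      refine mul_le_mul_of_nonneg_left ?_ (by positivity)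
      rw [← Real.rpow_natCast]
      exact Real.rpow_le_rpow_of_exponent_le hφ.le hk2
    have hcost := runCost_le hN
    have ht' : (t : ℝ) ≤ 31 * (Nat.fib (k + 5) : ℝ) * (I.length * runCost I.length) := by
      exact_mod_cast ht
    have hr : (0 : ℝ) ≤ runCost I.length := Nat.cast_nonneg _
    generalize (Nat.fib (k + 5) : ℝ) = f at hfib ht'
    generalize (runCost I.length : ℝ) = r at hcost ht' hr
    calc (t : ℝ) ≤ 31 * f * (I.length * r) := ht'
      _ ≤ 31 * (Real.goldenRatio ^ 5 * Real.goldenRatio ^ (1 / ε)) *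
          (I.length * (1600 / Real.log 2 * Real.log I.length)) := by
        gcongr
      _ = _ := by ring

end Final

end RunGen

theorem mainTheorem8 :
    -- the improved scheme: running time `O(φ ^ (1 / ε) * N * log N)`
    (∃ (A : RunGen.Program) (C : ℝ), ∀ ε : ℝ, 0 < ε →
      ∀ (α : Type*) [LinearOrder α] (M : ℕ), 1 ≤ M → ∀ I : List α,
        ∃ (S : List α) (t : ℕ), A.OutputsIn ⌈1 / ε⌉₊ M I S t ∧
          RunGen.IsOutput M I S ∧
          (RunGen.runs S : ℝ) ≤ (1 + ε) * (RunGen.opt M I : ℝ) ∧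
          (2 ≤ I.length →
            (t : ℝ) ≤ C * (Real.goldenRatio ^ (1 / ε) * I.length * Real.log I.length))) ∧
    -- the simple scheme: running time `O(2 ^ (1 / ε) * N * log N)`
    (∃ (A : RunGen.Program) (C : ℝ), ∀ ε : ℝ, 0 < ε →
      ∀ (α : Type*) [LinearOrder α] (M : ℕ), 1 ≤ M → ∀ I : List α,
        ∃ (S : List α) (t : ℕ), A.OutputsIn ⌈1 / ε⌉₊ M I S t ∧
          RunGen.IsOutput M I S ∧
          (RunGen.runs S : ℝ) ≤ (1 + ε) * (RunGen.opt M I : ℝ) ∧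
          (2 ≤ I.length →
            (t : ℝ) ≤ C * ((2 : ℝ) ^ (1 / ε) * I.length * Real.log I.length))) := by
  refine ⟨⟨RunGen.prog, _, fun ε hε α _ M hM I => RunGen.exists_approximation_scheme hε hM I⟩,
    RunGen.prog, 31 * Real.goldenRatio ^ 5 * (1600 / Real.log 2), fun ε hε α _ M hM I => ?_⟩
  -- The same program will do, since `φ ≤ 2`.
  obtain ⟨S, t, h1, h2, h3, h4⟩ := RunGen.exists_approximation_scheme hε hM I
  refine ⟨S, t, h1, h2, h3, fun hN => (h4 hN).trans ?_⟩
  have hφ := Real.goldenRatio_pos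
  have h2 : 0 < Real.log 2 := Real.log_pos (by norm_num)
  have hlog : 0 ≤ Real.log I.length := Real.log_natCast_nonneg _
  gcongr
  exact Real.goldenRatio_lt_two.le
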